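/- **Theorem (Error estimate).** Let $\Omega=[a,b]$, $a<b$, $T>0$, $k\ge 0$, $C>1$, $c_0\ge 0$. Let $u$ be a smooth ($C^\infty$ up to $t=0$ and $t=T$) solution of $u_t+u_x=0$ on $\Omega\times[0,T]$ with either periodic boundary conditions ($u(\cdot,t)$ extends to a smooth $(b-a)$-periodic function on $\mathbb R$) or compactly supported ones ($u(\cdot,t)$, extended by zero, is smooth with support in $(a,b)$ for all $t\in[0,T]$). Put $f(u)=u$, $U(u)=u^2/2$, $F(u)=u^2/2$, $v(u)=U'(u)$, $A(u)=U''(u)^{-1}$. *Mesh.* For $N\ge1$ let $h=(b-a)/N$, $x_{i+1/2}=a+ih$ ($0\le i\le N$), $K_i=[x_{i-1/2},x_{i+1/2}]$ with center $x_i$, and $V_h^k=\{w: w|_{K_i}\in P^k(K_i),\ 1\le i\le N\}$. Let $w^\pm_{i+1/2}$ be the limits of $w$ at $x_{i+1/2}$ from the right and from the left and $[\![w]\!]=w^+-w^-$. The exterior limits at $x_{1/2}$ and $x_{N+1/2}$ are taken from the periodic extension of $w$ in the periodic case, and are $0$ in the compactly supported case. *Fluxes.* $\hat f=\hat f^C+\hat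 f^D$ with $\hat f^C(u^-,u^+)=\frac12(f(u^+)+f(u^-))$ and $\hat f^D(u^-,u^+)=-\frac12\alpha(u^+-u^-)$, where $\alpha$ is the maximum of $|f'|$ between $u^-$ and $u^+$; and $\hat F(u^-,u^+)=\frac12(F(u^+)+F(u^-))$. Fluxes with index $i\pm1/2$ are evaluated at the one-sided limits of $u_h$ there. *Viscosity.* Let $\nu_i(x)=1-\big(\tfrac{x-x_i}{h/2}\big)^2$, let $v_h\in V_h^k$ interpolate $v(u_h)$ on each cell at the $k+1$ Gauss–Lobatto points (for $k=0$ the choice of $v_h$ is irrelevant, since the viscous term below vanishes), and $$E_i=\int_{K_i}\nu_i\,(v_h)_xA(u_h)(v_h)_x\,dx,\qquad F_i=\hat F_{i+1/2}-\hat F_{i-1/2}-\hat f^C_{i+1/2}(v_h)^-_{i+1/2}+\hat f^C_{i-1/2}(v_h)^+_{i-1/2}+\int_{K_i}f(u_h)(v_h)_x\,dx,$$ $$\sigma_i^{jump}=c_0\max_{K_i}|f'(u_h)|\Big(h\,\|[\![u_h]\!]\|_{\partial K_i}+\sum_{l=1}^k l(l+1)h^{l+1}\|[\![\partial_x^lu_h]\!]\|_{\partial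 K_i}\Big),$$ where $\|[\![w]\!]\|_{\partial K_i}=|[\![w]\!]_{i-1/2}|+|[\![w]\!]_{i+1/2}|$, and $$\sigma_i^{entropy}=\min\Big\{\max\Big\{\frac{F_i}{E_i},0\Big\},\,C\sigma_i^{jump}\Big\},\qquad \sigma_i=\max\{\sigma_i^{jump},\sigma_i^{entropy}\}$$ (with $F_i/E_i:=0$ if $E_i=0$; the viscous term below is then zero anyway). *Scheme.* A solution of the semi-discrete NOES-DG scheme is a differentiable map $t\mapsto u_h(\cdot,t)\in V_h^k$ on $[0,T]$ such that, for all $t\in[0,T]$, all $w\in V_h^k$ and all $i$, $$\int_{K_i}\frac{\partial u_h}{\partial t}w\,dx=\int_{K_i}f(u_h)w_x\,dx-\hat f_{i+1/2}w^-_{i+1/2}+\hat f_{i-1/2}w^+_{i-1/2}-\sigma_i\int_{K_i}\nu_i\,(v_h)_xA(u_h)\,w_x\,dx,$$ with the $L^2$-projected initial data $\int_{K_i}u_h(x,0)w\,dx=\int_{K_i}u(x,0)w\,dx$ for all $w\in V_h^k$ and all $i$. *Conclusion.* There is a constant $M>0$, which may depend on $a,b,T,k,C,c_0$, the type of boundary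 condition and $u$, but not on $N$ (that is, on $h$), on $u_h$ or on $t$, such that for every $N\ge1$, every solution $u_h$ of the scheme and every $t\in[0,T]$, $$\|u(\cdot,t)-u_h(\cdot,t)\|_{L^2(\Omega)}\le M\,h^{k+1}.$$ -/

import Mathlib

open scoped Polynomial ContDiff

namespace NOESDG

noncomputable section

/-- A scalar flux `f` in one space dimension together with an entropy pair `(U, F)`,
`F' = U' f'`. -/
structure EntropyLaw where
  f : ℝ → ℝ
  U : ℝ → ℝ
  F : ℝ → ℝ
  entropy_pair : ∀ s : ℝ, deriv F s = deriv U s * deriv f s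

/-- Linear advection `f(u) = u` with the square entropy `U(u) = u²/2`, whose entropy flux is
`F(u) = u²/2`. -/
def linearSquare : EntropyLaw where
  f := fun s => s
  U := fun s => s ^ 2 / 2
  F := fun s => s ^ 2 / 2
  entropy_pair := by intro s; simp

/-- The two kinds of boundary conditions. -/
inductive BoundaryCondition
  | periodic
  | compactSupport

/-- `u` is a smooth solution of `u_t + f(u)_x = 0` on `[a,b] × [0,T]`, extended in `x` to the
whole line: `(b-a)`-periodically for periodic boundary conditions, and by zero for compactly
supported ones (in which case the support of `u(·,t)` stays inside the open interval). -/
structure IsSmoothSolution (f : ℝ → ℝ) (a b T : ℝ) (bc : BoundaryCondition)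
    (u : ℝ → ℝ → ℝ) : Prop where
  smooth : ContDiffOn ℝ ∞ (fun p : ℝ × ℝ => u p.1 p.2) (Set.univ ×ˢ Set.Icc 0 T)
  pde : ∀ x : ℝ, ∀ t ∈ Set.Ioo 0 T,
    deriv (fun s => u x s) t + deriv (fun y => f (u y t)) x = 0
  boundary : match bc with
    | .periodic => ∀ x : ℝ, ∀ t ∈ Set.Icc 0 T, u (x + (b - a)) t = u x t
    | .compactSupport => ∀ t ∈ Set.Icc 0 T, tsupport (fun x => u x t) ⊆ Set.Ioo a b

/-! ### The uniform mesh with `N` cells -/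

/-- Mesh size `h`. -/
def meshSize (a b : ℝ) (N : ℕ) : ℝ := (b - a) / N

/-- Left end point of the cell with (zero-based) number `i`. -/
def xL (a b : ℝ) {N : ℕ} (i : Fin N) : ℝ := a + (i : ℕ) * meshSize a b N

/-- Right end point of the cell with number `i`. -/
def xR (a b : ℝ) {N : ℕ} (i : Fin N) : ℝ := a + ((i : ℕ) + 1) * meshSize a b N

/-- Center of the cell with number `i`. -/
def xC (a b : ℝ) {N : ℕ} (i : Fin N) : ℝ := (xL a b i + xR a b i) / 2

/-- The space `V_h^k`. A discontinuous piecewise polynomial is given by its polynomial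
(in the physical variable `x`) on each cell. -/
def DGSpace (N k : ℕ) : Set (Fin N → ℝ[X]) := {w | ∀ i, (w i).natDegree ≤ k}

/-! ### One-sided limits at the cell interfaces -/

/-- `w⁺` at the left end of cell `i` (limit from inside the cell). -/
def innerL (a b : ℝ) {N : ℕ} (w : Fin N → ℝ[X]) (i : Fin N) : ℝ := (w i).eval (xL a b i)

/-- `w⁻` at the right end of cell `i` (limit from inside the cell). -/
def innerR (a b : ℝ) {N : ℕ} (w : Fin N → ℝ[X]) (i : Fin N) : ℝ := (w i).eval (xR a b i)

/-- `w⁻` at the left end of cell `i`: the limit from the neighbouring cell on the left. At `x = a`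
the neighbour is the last cell (`i - 1` is cyclic in `Fin N`) for periodic boundary conditions,
and the exterior value is zero for compactly supported ones. -/
def outerL (bc : BoundaryCondition) (a b : ℝ) {N : ℕ} [NeZero N] (w : Fin N → ℝ[X])
    (i : Fin N) : ℝ :=
  match bc with
  | .periodic => innerR a b w (i - 1)
  | .compactSupport => if (i : ℕ) = 0 then 0 else innerR a b w (i - 1)

/-- `w⁺` at the right end of cell `i`: the limit from the neighbouring cell on the right. -/
def outerR (bc : BoundaryCondition) (a b : ℝ) {N : ℕ} [NeZero N] (w : Fin N → ℝ[X])
    (i : Fin N) : ℝ :=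
  match bc with
  | .periodic => innerL a b w (i + 1)
  | .compactSupport => if (i : ℕ) + 1 = N then 0 else innerL a b w (i + 1)

/-! ### Numerical fluxes, as functions of the two one-sided values -/

/-- Central part of the flux. -/
def fluxC (L : EntropyLaw) (um up : ℝ) : ℝ := (L.f up + L.f um) / 2

/-- Local wave speed: the maximum of `|f'|` on the interval between the two values. -/
def waveSpeed (L : EntropyLaw) (um up : ℝ) : ℝ :=
  sSup ((fun s => |deriv L.f s|) '' Set.uIcc um up)

/-- Diffusive part of the local Lax-Friedrichs flux. -/
def fluxD (L : EntropyLaw) (um up : ℝ) : ℝ := -(waveSpeed L um up * (up - um)) / 2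

/-- The local Lax-Friedrichs flux. -/
def flux (L : EntropyLaw) (um up : ℝ) : ℝ := fluxC L um up + fluxD L um up

/-- The central entropy flux. -/
def entropyFlux (L : EntropyLaw) (um up : ℝ) : ℝ := (L.F up + L.F um) / 2

/-! ### The artificial viscosity -/

/-- The weight `ν_i(x) = 1 - X_i(x)²`, `X_i(x) = (x - x_i)/(h/2)`. -/
def nu (a b : ℝ) {N : ℕ} (i : Fin N) (x : ℝ) : ℝ :=
  1 - ((x - xC a b i) / (meshSize a b N / 2)) ^ 2

/-- The Gauss-Lobatto points on the reference cell `[-1,1]`: the roots of `(X² - 1) P_k'(X)`, where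
`P_k` is the Legendre polynomial, a multiple of the `k`-th derivative of `(X² - 1)^k`. For
`k ≥ 1` these are `k + 1` points, among them `±1`. For `k = 0` there are none; then
the viscous term of the scheme vanishes whatever `v_h` is. -/
def gaussLobatto (k : ℕ) : Finset ℝ :=
  ((Polynomial.X ^ 2 - 1 : ℝ[X]) *
    Polynomial.derivative^[k + 1] ((Polynomial.X ^ 2 - 1 : ℝ[X]) ^ k)).roots.toFinset

/-- A point of the reference cell `[-1,1]` mapped to cell `i`. -/
def refMap (a b : ℝ) {N : ℕ} (i : Fin N) (ξ : ℝ) : ℝ := xC a b i + meshSize a b N / 2 * ξ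

/-- `v_h`: the polynomial on each cell interpolating the entropy variable `v(u_h) = U'(u_h)` at
the Gauss-Lobatto points. -/
def entropyVar (L : EntropyLaw) (k : ℕ) (a b : ℝ) {N : ℕ} (w : Fin N → ℝ[X]) :
    Fin N → ℝ[X] := fun i =>
  Lagrange.interpolate (gaussLobatto k) (refMap a b i)
    (fun ξ => deriv L.U ((w i).eval (refMap a b i ξ)))

/-- `A(u) = U''(u)⁻¹`. -/
def coeffA (L : EntropyLaw) (s : ℝ) : ℝ := (deriv (deriv L.U) s)⁻¹

/-- `‖[[∂_x^l w]]‖_{∂K_i}`: the sum of the absolute jumps of `∂_x^l w` at both ends of the cell. -/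
def jumpNorm (bc : BoundaryCondition) (a b : ℝ) {N : ℕ} [NeZero N] (w : Fin N → ℝ[X]) (l : ℕ)
    (i : Fin N) : ℝ :=
  let dw : Fin N → ℝ[X] := fun j => Polynomial.derivative^[l] (w j)
  |innerL a b dw i - outerL bc a b dw i| + |outerR bc a b dw i - innerR a b dw i|

/-- `σ_i^jump`, with `c_f = c₀ max_{K_i} |f'(u_h)|`. -/
def sigmaJump (L : EntropyLaw) (bc : BoundaryCondition) (k : ℕ) (c₀ a b : ℝ) {N : ℕ} [NeZero N]
    (w : Fin N → ℝ[X]) (i : Fin N) : ℝ :=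
  (c₀ * sSup ((fun x => |deriv L.f ((w i).eval x)|) '' Set.Icc (xL a b i) (xR a b i))) *
    (meshSize a b N * jumpNorm bc a b w 0 i +
      ∑ l ∈ Finset.Icc 1 k,
        (l : ℝ) * (l + 1) * meshSize a b N ^ (l + 1) * jumpNorm bc a b w l i)

/-- `E_i = ∫_{K_i} ν_i (v_h)_x A(u_h) (v_h)_x dx`. -/
def entropyE (L : EntropyLaw) (k : ℕ) (a b : ℝ) {N : ℕ} (w : Fin N → ℝ[X]) (i : Fin N) : ℝ :=
  ∫ x in (xL a b i)..(xR a b i),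
    nu a b i x * (entropyVar L k a b w i).derivative.eval x * coeffA L ((w i).eval x) *
      (entropyVar L k a b w i).derivative.eval x

/-- `F_i`, the entropy production of the central part of the scheme in cell `i`. -/
def entropyF (L : EntropyLaw) (bc : BoundaryCondition) (k : ℕ) (a b : ℝ) {N : ℕ} [NeZero N]
    (w : Fin N → ℝ[X]) (i : Fin N) : ℝ :=
  entropyFlux L (innerR a b w i) (outerR bc a b w i)
    - entropyFlux L (outerL bc a b w i) (innerL a b w i)
    - fluxC L (innerR a b w i) (outerR bc a b w i) * innerR a b (entropyVar L k a b w) i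
    + fluxC L (outerL bc a b w i) (innerL a b w i) * innerL a b (entropyVar L k a b w) i
    + ∫ x in (xL a b i)..(xR a b i),
        L.f ((w i).eval x) * (entropyVar L k a b w i).derivative.eval x

/-- `σ_i^entropy = min {max {F_i/E_i, 0}, C σ_i^jump}`. If `E_i = 0`, the quotient is read as `0`;
for the square entropy `u_h` is then constant in the cell and the viscous term is zero anyway. -/
def sigmaEntropy (L : EntropyLaw) (bc : BoundaryCondition) (k : ℕ) (C c₀ a b : ℝ) {N : ℕ}
    [NeZero N] (w : Fin N → ℝ[X]) (i : Fin N) : ℝ :=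
  min (max (entropyF L bc k a b w i / entropyE L k a b w i) 0)
    (C * sigmaJump L bc k c₀ a b w i)

/-- The viscosity parameter `σ_i = max {σ_i^jump, σ_i^entropy}`. -/
def sigma (L : EntropyLaw) (bc : BoundaryCondition) (k : ℕ) (C c₀ a b : ℝ) {N : ℕ}
    [NeZero N] (w : Fin N → ℝ[X]) (i : Fin N) : ℝ :=
  max (sigmaJump L bc k c₀ a b w i) (sigmaEntropy L bc k C c₀ a b w i)

/-! ### The scheme -/

/-- Right-hand side of the semi-discrete NOES-DG scheme in cell `i`, for the state `w` and the
test function `φ`. -/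
def schemeRHS (L : EntropyLaw) (bc : BoundaryCondition) (k : ℕ) (C c₀ a b : ℝ) {N : ℕ}
    [NeZero N] (w : Fin N → ℝ[X]) (i : Fin N) (φ : ℝ[X]) : ℝ :=
  (∫ x in (xL a b i)..(xR a b i), L.f ((w i).eval x) * φ.derivative.eval x)
    - flux L (innerR a b w i) (outerR bc a b w i) * φ.eval (xR a b i)
    + flux L (outerL bc a b w i) (innerL a b w i) * φ.eval (xL a b i)
    - sigma L bc k C c₀ a b w i *
      ∫ x in (xL a b i)..(xR a b i),
        nu a b i x * (entropyVar L k a b w i).derivative.eval x * coeffA L ((w i).eval x) *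
          φ.derivative.eval x

/-- `uh : [0,T] → V_h^k` is a solution of the semi-discrete NOES-DG scheme whose initial value is
the `L²` projection of `u₀`. -/
structure IsSolution (L : EntropyLaw) (bc : BoundaryCondition) (k : ℕ) (C c₀ a b T : ℝ) {N : ℕ}
    [NeZero N] (u₀ : ℝ → ℝ) (uh : ℝ → Fin N → ℝ[X]) : Prop where
  mem : ∀ t ∈ Set.Icc 0 T, uh t ∈ DGSpace N k
  differentiable : ∀ (i : Fin N) (n : ℕ),
    DifferentiableOn ℝ (fun t => (uh t i).coeff n) (Set.Icc 0 T)
  initial : ∀ (i : Fin N) (φ : ℝ[X]), φ.natDegree ≤ k →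
    ∫ x in (xL a b i)..(xR a b i), (uh 0 i).eval x * φ.eval x =
      ∫ x in (xL a b i)..(xR a b i), u₀ x * φ.eval x
  scheme : ∀ t ∈ Set.Icc 0 T, ∀ (i : Fin N) (φ : ℝ[X]), φ.natDegree ≤ k →
    ∫ x in (xL a b i)..(xR a b i),
        derivWithin (fun s => (uh s i).eval x) (Set.Icc 0 T) t * φ.eval x =
      schemeRHS L bc k C c₀ a b (uh t) i φ

/-- `‖g - w‖_{L²(Ω)}` for a function `g` and a piecewise polynomial `w`. -/
def l2Error (a b : ℝ) {N : ℕ} (g : ℝ → ℝ) (w : Fin N → ℝ[X]) : ℝ :=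
  Real.sqrt (∑ i : Fin N, ∫ x in (xL a b i)..(xR a b i), (g x - (w i).eval x) ^ 2)

end

end NOESDG

/-!
The exact solution is the translate `u (x, t) = u₀ (x - t)`. On each cell, project it to the
Gauss-Radau polynomial `P u` of degree at most `k` that has the same value at the right end and the
same moments against polynomials of degree less than `k`, and put `ξ = P u - u_h`. For `f u = u` the
numerical flux is the upwind flux, so the projection error `u - P u` contributes neither to the
volume term nor to the fluxes, and the fluxes of `ξ` dissipate `∑ ‖ξ‖²`.

For the square entropy `v_h` has the same derivative as `u_h` in each cell, because `u_h`
interpolates itself at the `k + 1` Gauss-Lobatto points. The viscous term is therefore linear in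
`u_h = P u - ξ` once `σ` is fixed. Its part in `ξ` is dissipative since `σ ≥ 0`. Its part in `P u`
is, after scaling, `σ` times a bounded quantity times `‖ξ‖`; as `u` has no jumps, `σ` is itself
bounded by the projection and discrete errors in the neighbouring cells. Hence the viscosity costs
no more than the square of the error, and Grönwall's inequality concludes.
-/

namespace NOESDG

open Polynomial

/-! ### Gauss–Lobatto interpolation -/

/-- The polynomial `(X² - 1)^k`, whose `k`-th derivative is by Rodrigues' formula a multiple of the
Legendre polynomial of degree `k`. -/
noncomputable def rodrigues (R : Type*) [CommRing R] (k : ℕ) : R[X] := (X ^ 2 - 1) ^ k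

theorem X_sq_sub_one_mul_derivative_rodrigues (R : Type*) [CommRing R] (k : ℕ) :
    (X ^ 2 - 1) * derivative (rodrigues R k) = 2 * (k : R[X]) * X * rodrigues R k := by
  rcases k with _ | k
  · simp [rodrigues]
  · simp only [rodrigues, derivative_pow_succ, derivative_sub,
      derivative_X, derivative_one, map_add, map_natCast, map_one]
    push_cast
    ring

theorem X_sq_sub_one_mul_iterate_derivative_rodrigues (R : Type*) [CommRing R] (k j : ℕ) :
    (X ^ 2 - 1) * derivative^[j + 2] (rodrigues R k) =
      2 * ((k : R[X]) - (j : R[X]) - 1) * X * derivative^[j + 1] (rodrigues R k) +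
        ((j : R[X]) + 1) * (2 * (k : R[X]) - (j : R[X])) * derivative^[j] (rodrigues R k) := by
  induction j with
  | zero =>
    have h := congrArg derivative (X_sq_sub_one_mul_derivative_rodrigues R k)
    simp only [derivative_mul, derivative_sub, derivative_one, derivative_X_sq, derivative_X,
      derivative_natCast, derivative_ofNat, map_ofNat] at h
    simp only [Function.iterate_succ, Function.iterate_zero, Function.comp_apply, id_eq]
    push_cast
    linear_combination h
  | succ j ih =>
    have h := congrArg derivative ih
    simp only [derivative_mul, derivative_add, derivative_sub, derivative_one, derivative_X_sq,
      derivative_X, derivative_natCast, derivative_ofNat, map_ofNat,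
      ← Function.iterate_succ_apply' derivative, Nat.succ_eq_add_one] at h
    push_cast
    linear_combination h

theorem monic_rodrigues (R : Type*) [CommRing R] (k : ℕ) : (rodrigues R k).Monic := by
  simpa [rodrigues] using (monic_X_pow_sub_C (1 : R) two_ne_zero).pow k

theorem natDegree_rodrigues (R : Type*) [CommRing R] [Nontrivial R] (k : ℕ) :
    (rodrigues R k).natDegree = 2 * k := by
  have h : ((X : R[X]) ^ 2 - 1).Monic := by simpa using monic_X_pow_sub_C (1 : R) two_ne_zero
  have h2 : ((X : R[X]) ^ 2 - 1).natDegree = 2 := by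
    simpa using natDegree_X_pow_sub_C (n := 2) (r := (1 : R))
  rw [rodrigues, h.natDegree_pow, h2, mul_comm]

theorem iterate_derivative_rodrigues_ne_zero {R : Type*} [CommRing R] [CharZero R] {k j : ℕ}
    (hj : j ≤ 2 * k) : derivative^[j] (rodrigues R k) ≠ 0 := by
  intro h
  have hlead : (rodrigues R k).coeff (2 * k) = 1 :=
    natDegree_rodrigues R k ▸ (monic_rodrigues R k).coeff_natDegree
  have hcoeff := coeff_iterate_derivative (p := rodrigues R k) (k := j) (2 * k - j)
  rw [h, coeff_zero, Nat.sub_add_cancel hj, hlead, nsmul_one, eq_comm, Nat.cast_eq_zero,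
    Nat.descFactorial_eq_zero_iff_lt] at hcoeff
  omega

theorem one_neg_one_subset_roots_iterate_derivative_rodrigues {k j : ℕ} (hj : j < k) :
    ({1, -1} : Finset ℝ) ⊆ (derivative^[j] (rodrigues ℝ k)).roots.toFinset := by
  intro x hx
  have hx0 : eval x ((X : ℝ[X]) ^ 2 - 1) = 0 := by
    rcases Finset.mem_insert.mp hx with rfl | hx
    · simp
    · simp [Finset.mem_singleton.mp hx]
  obtain ⟨q, hq⟩ := pow_sub_dvd_iterate_derivative_pow ((X : ℝ[X]) ^ 2 - 1) k j
  rw [Multiset.mem_toFinset, mem_roots (iterate_derivative_rodrigues_ne_zero (by omega)), IsRoot,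
    rodrigues, hq, eval_mul, eval_pow, hx0, zero_pow (by omega), zero_mul]

/- By Rolle's theorem each differentiation keeps one root between any two consecutive ones, and
the endpoints `±1` remain roots until the `k`-th derivative. -/
theorem add_two_le_card_roots_iterate_derivative_rodrigues {k j : ℕ} (hj : j < k) :
    j + 2 ≤ (derivative^[j] (rodrigues ℝ k)).roots.toFinset.card := by
  have hcard : ({1, -1} : Finset ℝ).card = 2 := Finset.card_pair (by norm_num)
  induction j with
  | zero =>
    simpa only [hcard] using
      Finset.card_le_card (one_neg_one_subset_roots_iterate_derivative_rodrigues hj)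
  | succ j ih =>
    set f := derivative^[j] (rodrigues ℝ k)
    set f' := derivative^[j + 1] (rodrigues ℝ k) with hf'
    have hrolle : f.roots.toFinset.card ≤ (f'.roots.toFinset \ f.roots.toFinset).card + 1 := by
      rw [hf', Function.iterate_succ_apply']
      exact card_roots_toFinset_le_card_roots_derivative_sdiff_roots_succ f
    have hdisj : Disjoint (f'.roots.toFinset \ f.roots.toFinset) {1, -1} :=
      Finset.disjoint_of_subset_right
        (one_neg_one_subset_roots_iterate_derivative_rodrigues (by omega)) Finset.sdiff_disjoint
    have hunion := Finset.card_le_card (Finset.union_subset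
      (Finset.sdiff_subset (s := f'.roots.toFinset) (t := f.roots.toFinset))
      (one_neg_one_subset_roots_iterate_derivative_rodrigues hj))
    rw [Finset.card_union_of_disjoint hdisj, hcard] at hunion
    have := ih (by omega)
    omega

theorem succ_le_card_gaussLobatto {k : ℕ} (hk : 1 ≤ k) : k + 1 ≤ (gaussLobatto k).card := by
  obtain ⟨j, rfl⟩ := Nat.exists_eq_add_of_le' hk
  have hc : ((j : ℝ) + 1) * (j + 2) ≠ 0 := by positivity
  have hlegendre : (X ^ 2 - 1) * derivative^[j + 2] (rodrigues ℝ (j + 1)) =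
      C (((j : ℝ) + 1) * (j + 2)) * derivative^[j] (rodrigues ℝ (j + 1)) := by
    rw [X_sq_sub_one_mul_iterate_derivative_rodrigues]
    simp only [map_mul, map_add, map_natCast, map_one, map_ofNat]
    push_cast
    ring
  change _ ≤ ((X ^ 2 - 1) * derivative^[j + 2] (rodrigues ℝ (j + 1))).roots.toFinset.card
  rw [hlegendre, roots_C_mul _ hc]
  exact add_two_le_card_roots_iterate_derivative_rodrigues (Nat.lt_succ_self j)

theorem deriv_linearSquare_U : deriv linearSquare.U = id := by
  funext s
  simp [linearSquare]

theorem derivative_entropyVar {a b : ℝ} {N k : ℕ} (hh : meshSize a b N ≠ 0)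
    (w : Fin N → ℝ[X]) (i : Fin N) (hw : (w i).natDegree ≤ k) :
    derivative (entropyVar linearSquare k a b w i) = derivative (w i) := by
  rcases Nat.eq_zero_or_pos k with rfl | hk
  · have h0 : gaussLobatto 0 = ∅ := by simp [gaussLobatto]
    rw [derivative_of_natDegree_zero (Nat.le_zero.mp hw), entropyVar, h0,
      Lagrange.interpolate_empty, derivative_zero]
  · have hinj : Set.InjOn (refMap a b i) (gaussLobatto k) := fun x _ y _ hxy => by
      simpa [refMap, hh] using hxy
    have hdeg : (w i).degree < (gaussLobatto k).card :=
      (natDegree_le_iff_degree_le.mp hw).trans_lt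
        (by exact_mod_cast succ_le_card_gaussLobatto hk)
    rw [entropyVar, deriv_linearSquare_U]
    exact congrArg derivative (Lagrange.eq_interpolate hinj hdeg).symm

/-! ### Polynomials on the reference cell `[0,1]` -/

theorem sq_integral_abs_le_integral_sq {g : ℝ → ℝ} (hg : Continuous g) :
    (∫ x in (0 : ℝ)..1, |g x|) ^ 2 ≤ ∫ x in (0 : ℝ)..1, g x ^ 2 := by
  set m := ∫ x in (0 : ℝ)..1, |g x|
  have hvariance : 0 ≤ ∫ x in (0 : ℝ)..1, (|g x| - m) ^ 2 :=
    intervalIntegral.integral_nonneg zero_le_one fun x _ => sq_nonneg _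
  have hexpand : ∀ x, (|g x| - m) ^ 2 = g x ^ 2 - 2 * m * |g x| + m ^ 2 := fun x => by
    rw [sub_sq, sq_abs]
    ring
  simp only [hexpand] at hvariance
  rw [intervalIntegral.integral_add (Continuous.intervalIntegrable (by fun_prop) _ _)
      (Continuous.intervalIntegrable (by fun_prop) _ _),
    intervalIntegral.integral_sub (Continuous.intervalIntegrable (by fun_prop) _ _)
      (Continuous.intervalIntegrable (by fun_prop) _ _),
    intervalIntegral.integral_const_mul, intervalIntegral.integral_const] at hvariance
  simp only [sub_zero, one_smul] at hvariance
  linarith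

theorem abs_integral_mul_le_mul_sqrt {f g : ℝ → ℝ} (hf : Continuous f) (hg : Continuous g) {B : ℝ}
    (hB : ∀ x ∈ Set.Icc (0 : ℝ) 1, |f x| ≤ B) :
    |∫ x in (0 : ℝ)..1, f x * g x| ≤ B * √(∫ x in (0 : ℝ)..1, g x ^ 2) := by
  have hB0 : 0 ≤ B := (abs_nonneg _).trans (hB 0 (by simp))
  calc |∫ x in (0 : ℝ)..1, f x * g x|
      ≤ ∫ x in (0 : ℝ)..1, |f x * g x| :=
        intervalIntegral.abs_integral_le_integral_abs zero_le_one
    _ ≤ ∫ x in (0 : ℝ)..1, B * |g x| :=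
        intervalIntegral.integral_mono_on zero_le_one
          (Continuous.intervalIntegrable (by fun_prop) _ _)
          (Continuous.intervalIntegrable (by fun_prop) _ _) fun x hx => by
            rw [abs_mul]
            exact mul_le_mul_of_nonneg_right (hB x hx) (abs_nonneg _)
    _ = B * ∫ x in (0 : ℝ)..1, |g x| := intervalIntegral.integral_const_mul _ _
    _ ≤ B * √(∫ x in (0 : ℝ)..1, g x ^ 2) :=
        mul_le_mul_of_nonneg_left (Real.le_sqrt_of_sq_le (sq_integral_abs_le_integral_sq hg)) hB0

theorem eq_zero_of_integral_mul_sq_eq_zero {ρ : ℝ → ℝ} (hρ : Continuous ρ)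
    (hpos : ∀ x ∈ Set.Ioo (0 : ℝ) 1, 0 < ρ x) {p : ℝ[X]}
    (h : ∫ x in (0 : ℝ)..1, ρ x * p.eval x ^ 2 = 0) : p = 0 := by
  by_contra hp
  obtain ⟨x, hx, hroot⟩ :=
    (Set.Ioo_infinite (zero_lt_one' ℝ)).exists_notMem_finset p.roots.toFinset
  have hx0 : p.eval x ≠ 0 := fun h0 => hroot (Multiset.mem_toFinset.mpr ((mem_roots hp).mpr h0))
  have hρ0 : ∀ y ∈ Set.Icc (0 : ℝ) 1, 0 ≤ ρ y := fun y hy =>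
    closure_minimal (t := {z | 0 ≤ ρ z}) (fun z hz => (hpos z hz).le)
      (isClosed_le continuous_const hρ) (by rwa [closure_Ioo zero_ne_one])
  refine h.not_gt (intervalIntegral.integral_pos zero_lt_one
    (by fun_prop) (fun y hy => mul_nonneg (hρ0 y (Set.Ioc_subset_Icc_self hy)) (sq_nonneg _))
    ⟨x, Set.Ioo_subset_Icc_self hx, mul_pos (hpos x hx) (by positivity)⟩)

/-- The `L²(0,1)` inner product of polynomials. -/
noncomputable def pairing : LinearMap.BilinForm ℝ ℝ[X] :=
  LinearMap.mk₂ ℝ (fun p q => ∫ x in (0 : ℝ)..1, p.eval x * q.eval x)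
    (fun p p' q => by
      simp only [eval_add, add_mul]
      exact intervalIntegral.integral_add (Continuous.intervalIntegrable (by fun_prop) _ _)
        (Continuous.intervalIntegrable (by fun_prop) _ _))
    (fun c p q => by
      simp only [eval_smul, smul_eq_mul, mul_assoc]
      exact intervalIntegral.integral_const_mul _ _)
    (fun p q q' => by
      simp only [eval_add, mul_add]
      exact intervalIntegral.integral_add (Continuous.intervalIntegrable (by fun_prop) _ _)
        (Continuous.intervalIntegrable (by fun_prop) _ _))
    (fun c p q => by
      simp only [eval_smul, smul_eq_mul, mul_left_comm _ c]
      exact intervalIntegral.integral_const_mul _ _)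

theorem pairing_apply (p q : ℝ[X]) :
    pairing p q = ∫ x in (0 : ℝ)..1, p.eval x * q.eval x := rfl

theorem pairing_comm (p q : ℝ[X]) : pairing p q = pairing q p := by
  simp only [pairing_apply, mul_comm]

theorem pairing_self (p : ℝ[X]) : pairing p p = ∫ x in (0 : ℝ)..1, p.eval x ^ 2 := by
  simp only [pairing_apply, sq]

theorem eq_zero_of_pairing_self_eq_zero {p : ℝ[X]} (h : pairing p p = 0) : p = 0 :=
  eq_zero_of_integral_mul_sq_eq_zero (ρ := fun _ => 1) continuous_const
    (fun _ _ => zero_lt_one) (by simpa only [one_mul, pairing_self] using h)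

/-- The norm of `L²(0,1)` on polynomials, in which the error on each cell is measured. -/
noncomputable def l2Norm (p : ℝ[X]) : ℝ := √(pairing p p)

theorem l2Norm_nonneg (p : ℝ[X]) : 0 ≤ l2Norm p := Real.sqrt_nonneg _

theorem sq_l2Norm (p : ℝ[X]) : l2Norm p ^ 2 = pairing p p :=
  Real.sq_sqrt (pairing_self p ▸
    intervalIntegral.integral_nonneg zero_le_one fun _ _ => sq_nonneg _)

theorem abs_integral_mul_eval_le {f : ℝ → ℝ} (hf : Continuous f) {B : ℝ}
    (hB : ∀ x ∈ Set.Icc (0 : ℝ) 1, |f x| ≤ B) (q : ℝ[X]) :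
    |∫ x in (0 : ℝ)..1, f x * q.eval x| ≤ B * l2Norm q := by
  rw [l2Norm, pairing_self]
  exact abs_integral_mul_le_mul_sqrt hf q.continuous hB

theorem mem_degreeLT_succ {R : Type*} [Semiring R] {p : R[X]} {k : ℕ} :
    p ∈ degreeLT R (k + 1) ↔ p.natDegree ≤ k := by
  rw [degreeLT_succ_eq_degreeLE, mem_degreeLE, natDegree_le_iff_degree_le]

theorem finrank_degreeLT (n : ℕ) : Module.finrank ℝ (degreeLT ℝ n) = n := by
  rw [Module.finrank_eq_card_basis (degreeLT.basis ℝ n), Fintype.card_fin]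

theorem exists_pairing_eq (k : ℕ) (ℓ : ℝ[X] →ₗ[ℝ] ℝ) :
    ∃ r : ℝ[X], ∀ q : ℝ[X], q.natDegree ≤ k → ℓ q = pairing r q := by
  let B := pairing.restrict (degreeLT ℝ (k + 1))
  have hdefinite : ∀ p, B p p = 0 → p = 0 := fun p hp =>
    Subtype.ext (eq_zero_of_pairing_self_eq_zero hp)
  have hB : B.Nondegenerate :=
    ⟨fun p hp => hdefinite p (hp p), fun p hp => hdefinite p (hp p)⟩
  refine ⟨(B.toDual hB).symm (ℓ.domRestrict _), fun q hq => ?_⟩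
  exact (LinearMap.BilinForm.apply_toDual_symm_apply (hB := hB) (ℓ.domRestrict _)
    ⟨q, mem_degreeLT_succ.mpr hq⟩).symm

theorem exists_abs_le_l2Norm (k : ℕ) (ℓ : ℝ[X] →ₗ[ℝ] ℝ) :
    ∃ K : ℝ, 0 ≤ K ∧ ∀ q : ℝ[X], q.natDegree ≤ k → |ℓ q| ≤ K * l2Norm q := by
  obtain ⟨r, hr⟩ := exists_pairing_eq k ℓ
  obtain ⟨K, hK⟩ :=
    isCompact_Icc.exists_bound_of_continuousOn (s := Set.Icc (0 : ℝ) 1) r.continuous.continuousOn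
  refine ⟨K, (norm_nonneg _).trans (hK 0 (by simp)), fun q hq => ?_⟩
  rw [hr q hq]
  exact abs_integral_mul_eval_le r.continuous hK q

theorem abs_iterate_derivative_eval_le {k : ℕ} {q : ℝ[X]} (hq : q.natDegree ≤ k) {M : ℝ}
    (hM : ∀ n ≤ k, |q.coeff n| ≤ M) (l : ℕ) {s : ℝ} (hs : s ∈ Set.Icc (0 : ℝ) 1) :
    |(derivative^[l] q).eval s| ≤ (∑ n ∈ Finset.range (k + 1), (n.descFactorial l : ℝ)) * M := by
  rw [q.as_sum_range_C_mul_X_pow' (Nat.lt_succ_of_le hq), iterate_derivative_sum, eval_finsetSum,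
    Finset.sum_mul]
  refine (Finset.abs_sum_le_sum_abs _ _).trans (Finset.sum_le_sum fun n hn => ?_)
  have hcoeff := hM n (Nat.lt_succ_iff.mp (Finset.mem_range.mp hn))
  have hpow : s ^ (n - l) ≤ 1 := pow_le_one₀ hs.1 hs.2
  have hpow0 : 0 ≤ s ^ (n - l) := pow_nonneg hs.1 _
  rw [iterate_derivative_C_mul, iterate_derivative_X_pow_eq_natCast_mul]
  simp only [eval_mul, eval_C, eval_natCast, eval_pow, eval_X, abs_mul, Nat.abs_cast,
    abs_of_nonneg hpow0]
  calc |q.coeff n| * (n.descFactorial l * s ^ (n - l))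
      ≤ M * (n.descFactorial l * 1) := by gcongr; exact (abs_nonneg _).trans hcoeff
    _ = n.descFactorial l * M := by ring

theorem exists_abs_iterate_derivative_eval_le (k m : ℕ) :
    ∃ K : ℝ, 0 ≤ K ∧ ∀ (q : ℝ[X]) (M : ℝ), q.natDegree ≤ k → (∀ n ≤ k, |q.coeff n| ≤ M) →
      ∀ l ≤ m, ∀ s ∈ Set.Icc (0 : ℝ) 1, |(derivative^[l] q).eval s| ≤ K * M := by
  refine ⟨∑ l ∈ Finset.range (m + 1), ∑ n ∈ Finset.range (k + 1), (n.descFactorial l : ℝ),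
    by positivity, fun q M hq hM l hl s hs => ?_⟩
  refine (abs_iterate_derivative_eval_le hq hM l hs).trans
    (mul_le_mul_of_nonneg_right ?_ ((abs_nonneg _).trans (hM 0 (Nat.zero_le _))))
  exact Finset.single_le_sum (f := fun l => ∑ n ∈ Finset.range (k + 1), (n.descFactorial l : ℝ))
    (fun l _ => by positivity) (Finset.mem_range.mpr (Nat.lt_succ_of_le hl))

theorem exists_inverse_inequality (k m : ℕ) :
    ∃ K : ℝ, 0 ≤ K ∧ ∀ q : ℝ[X], q.natDegree ≤ k → ∀ l ≤ m, ∀ s ∈ Set.Icc (0 : ℝ) 1,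
      |(derivative^[l] q).eval s| ≤ K * l2Norm q := by
  choose c hc0 hc using fun n => exists_abs_le_l2Norm k (lcoeff ℝ n)
  obtain ⟨D, hD0, hD⟩ := exists_abs_iterate_derivative_eval_le k m
  refine ⟨D * ∑ n ∈ Finset.range (k + 1), c n,
    mul_nonneg hD0 (Finset.sum_nonneg fun n _ => hc0 n), fun q hq l hl s hs => ?_⟩
  rw [mul_assoc]
  refine hD q _ hq (fun n hn => (hc n q hq).trans ?_) l hl s hs
  exact mul_le_mul_of_nonneg_right (Finset.single_le_sum (fun n _ => hc0 n)
    (Finset.mem_range.mpr (Nat.lt_succ_of_le hn))) (l2Norm_nonneg q)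

/-! ### The Gauss–Radau projection -/

/-- The data prescribed by the Gauss–Radau projection of `g`: its moments of order less than `k`
on `[0,1]` and its value at the outflow point `1`. -/
noncomputable def radauData (k : ℕ) (g : ℝ → ℝ) : (Fin k → ℝ) × ℝ :=
  (fun j => ∫ x in (0 : ℝ)..1, x ^ (j : ℕ) * g x, g 1)

theorem eq_zero_of_radauData_eq_zero {k : ℕ} {p : ℝ[X]} (hp : p.natDegree ≤ k)
    (h : radauData k p.eval = 0) : p = 0 := by
  obtain ⟨q, rfl⟩ := dvd_iff_isRoot.mpr (congrArg Prod.snd h : p.eval 1 = 0)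
  by_contra hne
  have hq : q ≠ 0 := right_ne_zero_of_mul hne
  have hdeg : q.natDegree < k := by
    rw [natDegree_mul (X_sub_C_ne_zero 1) hq, natDegree_X_sub_C] at hp
    omega
  have hmoment : ∀ j < k, pairing (X ^ j) ((X - C 1) * q) = 0 := fun j hj => by
    simp only [pairing_apply, eval_pow, eval_X]
    exact congrFun (congrArg Prod.fst h) ⟨j, hj⟩
  have horth : pairing q ((X - C 1) * q) = 0 :=
    calc pairing q ((X - C 1) * q)
        = pairing (∑ j ∈ Finset.range k, q.coeff j • X ^ j) ((X - C 1) * q) := by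
          simp only [smul_eq_C_mul, ← q.as_sum_range_C_mul_X_pow' hdeg]
      _ = ∑ j ∈ Finset.range k, q.coeff j * pairing (X ^ j) ((X - C 1) * q) := by
          simp only [map_sum, map_smul, LinearMap.sum_apply, LinearMap.smul_apply, smul_eq_mul]
      _ = 0 := Finset.sum_eq_zero fun j hj => by
          rw [hmoment j (Finset.mem_range.mp hj), mul_zero]
  refine hq (eq_zero_of_integral_mul_sq_eq_zero (ρ := fun x => 1 - x) (by fun_prop)
    (fun x hx => sub_pos.mpr hx.2) ?_)
  rw [← neg_eq_zero, ← intervalIntegral.integral_neg, ← horth, pairing_apply]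
  congr 1
  funext x
  simp only [eval_mul, eval_sub, eval_X, eval_C]
  ring

/-- The Gauss–Radau data of a polynomial, as a linear map. -/
noncomputable def radauMap (k : ℕ) : ℝ[X] →ₗ[ℝ] (Fin k → ℝ) × ℝ :=
  (LinearMap.pi fun j : Fin k => pairing (X ^ (j : ℕ))).prod (leval 1)

theorem radauMap_apply (k : ℕ) (p : ℝ[X]) : radauMap k p = radauData k p.eval := by
  refine Prod.ext (funext fun j => ?_) rfl
  change pairing (X ^ (j : ℕ)) p = _
  simp only [pairing_apply, eval_pow, eval_X, radauData]

/-- Polynomials of degree at most `k` correspond to their Gauss–Radau data. -/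
noncomputable def radauEquiv (k : ℕ) : degreeLT ℝ (k + 1) ≃ₗ[ℝ] (Fin k → ℝ) × ℝ :=
  LinearEquiv.ofInjectiveOfFinrankEq ((radauMap k).domRestrict _)
    (LinearMap.ker_eq_bot.mp <| LinearMap.ker_eq_bot'.mpr fun p hp => Subtype.ext <|
      eq_zero_of_radauData_eq_zero (mem_degreeLT_succ.mp p.2) <| by
        rwa [← radauMap_apply])
    (by simp [finrank_degreeLT])

theorem radauEquiv_apply (k : ℕ) (p : degreeLT ℝ (k + 1)) :
    radauEquiv k p = radauData k p.1.eval :=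
  radauMap_apply k p

/-- The Gauss–Radau projection of `g`: the polynomial of degree at most `k` with the same moments
of order less than `k` and the same value at `1`. -/
noncomputable def radau (k : ℕ) (g : ℝ → ℝ) : ℝ[X] :=
  ((radauEquiv k).symm (radauData k g) : ℝ[X])

theorem natDegree_radau_le (k : ℕ) (g : ℝ → ℝ) : (radau k g).natDegree ≤ k :=
  mem_degreeLT_succ.mp ((radauEquiv k).symm (radauData k g)).2

theorem radauData_radau (k : ℕ) (g : ℝ → ℝ) : radauData k (radau k g).eval = radauData k g := by
  rw [radau, ← radauEquiv_apply, LinearEquiv.apply_symm_apply]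

theorem eval_one_radau (k : ℕ) (g : ℝ → ℝ) : (radau k g).eval 1 = g 1 :=
  congrArg Prod.snd (radauData_radau k g)

theorem integral_pow_mul_radau {k j : ℕ} (hj : j < k) (g : ℝ → ℝ) :
    ∫ x in (0 : ℝ)..1, x ^ j * (radau k g).eval x = ∫ x in (0 : ℝ)..1, x ^ j * g x :=
  congrFun (congrArg Prod.fst (radauData_radau k g)) ⟨j, hj⟩

theorem integral_radau_mul {k : ℕ} {g : ℝ → ℝ} (hg : Continuous g) {q : ℝ[X]}
    (hq : q.natDegree < k) :
    ∫ x in (0 : ℝ)..1, (radau k g).eval x * q.eval x = ∫ x in (0 : ℝ)..1, g x * q.eval x := by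
  have expand : ∀ f : ℝ → ℝ, Continuous f → ∫ x in (0 : ℝ)..1, f x * q.eval x =
      ∑ j ∈ Finset.range k, q.coeff j * ∫ x in (0 : ℝ)..1, x ^ j * f x := fun f hf => by
    simp only [← intervalIntegral.integral_const_mul]
    rw [← intervalIntegral.integral_finsetSum fun j _ =>
      Continuous.intervalIntegrable (by fun_prop) _ _]
    congr 1
    funext x
    rw [eval_eq_sum_range' hq, Finset.mul_sum]
    exact Finset.sum_congr rfl fun j _ => by ring
  rw [expand _ (radau k g).continuous, expand g hg]
  exact Finset.sum_congr rfl fun j hj => by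
    rw [integral_pow_mul_radau (Finset.mem_range.mp hj)]

theorem radau_eval {k : ℕ} {p : ℝ[X]} (hp : p.natDegree ≤ k) : radau k p.eval = p := by
  change (((radauEquiv k).symm (radauData k (⟨p, mem_degreeLT_succ.mpr hp⟩ :
    degreeLT ℝ (k + 1)).1.eval) : degreeLT ℝ (k + 1)) : ℝ[X]) = p
  rw [← radauEquiv_apply, LinearEquiv.symm_apply_apply]

theorem radau_sub (k : ℕ) {f g : ℝ → ℝ} (hf : Continuous f) (hg : Continuous g) :
    radau k (fun x => f x - g x) = radau k f - radau k g := by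
  have hdata : radauData k (fun x => f x - g x) = radauData k f - radauData k g := by
    refine Prod.ext (funext fun j => ?_) rfl
    simp only [radauData, mul_sub, Prod.fst_sub, Pi.sub_apply]
    exact intervalIntegral.integral_sub (Continuous.intervalIntegrable (by fun_prop) _ _)
      (Continuous.intervalIntegrable (by fun_prop) _ _)
  rw [radau, hdata, map_sub, Submodule.coe_sub, radau, radau]

theorem exists_coeff_radau_eq (k n : ℕ) : ∃ L : ((Fin k → ℝ) × ℝ) →L[ℝ] ℝ,
    ∀ g : ℝ → ℝ, (radau k g).coeff n = L (radauData k g) :=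
  ⟨LinearMap.toContinuousLinearMap
    (lcoeff ℝ n ∘ₗ (degreeLT ℝ (k + 1)).subtype ∘ₗ (radauEquiv k).symm.toLinearMap),
    fun _ => rfl⟩

theorem norm_radauData_le (k : ℕ) {g : ℝ → ℝ} {B : ℝ}
    (hB : ∀ x ∈ Set.Icc (0 : ℝ) 1, |g x| ≤ B) : ‖radauData k g‖ ≤ B := by
  have hB0 : 0 ≤ B := (abs_nonneg _).trans (hB 1 (by simp))
  refine norm_prod_le_iff.mpr ⟨(pi_norm_le_iff_of_nonneg hB0).mpr fun j => ?_, hB 1 (by simp)⟩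
  refine (intervalIntegral.norm_integral_le_of_norm_le_const (C := B) fun x hx => ?_).trans
    (by simp)
  rw [Set.uIoc_of_le zero_le_one] at hx
  rw [norm_mul, norm_pow, Real.norm_of_nonneg hx.1.le]
  exact (mul_le_of_le_one_left (norm_nonneg _) (pow_le_one₀ hx.1.le hx.2)).trans
    (hB x ⟨hx.1.le, hx.2⟩)

theorem exists_abs_radau_le (k m : ℕ) : ∃ K : ℝ, 0 ≤ K ∧ ∀ (g : ℝ → ℝ) (B : ℝ),
    (∀ x ∈ Set.Icc (0 : ℝ) 1, |g x| ≤ B) → ∀ l ≤ m, ∀ s ∈ Set.Icc (0 : ℝ) 1,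
      |(derivative^[l] (radau k g)).eval s| ≤ K * B := by
  choose L hL using exists_coeff_radau_eq k
  obtain ⟨K, hK0, hK⟩ := exists_abs_iterate_derivative_eval_le k m
  refine ⟨K * ∑ n ∈ Finset.range (k + 1), ‖L n‖, by positivity, fun g B hB l hl s hs => ?_⟩
  rw [mul_assoc]
  refine hK _ _ (natDegree_radau_le k g) (fun n hn => ?_) l hl s hs
  have hdata := norm_radauData_le k hB
  calc |(radau k g).coeff n| = ‖L n (radauData k g)‖ := by rw [hL, Real.norm_eq_abs]
    _ ≤ ‖L n‖ * B := (L n).le_opNorm_of_le hdata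
    _ ≤ (∑ n ∈ Finset.range (k + 1), ‖L n‖) * B := by
        refine mul_le_mul_of_nonneg_right ?_ ((norm_nonneg _).trans hdata)
        exact Finset.single_le_sum (f := fun n => ‖L n‖) (fun n _ => norm_nonneg _)
          (Finset.mem_range.mpr (Nat.lt_succ_of_le hn))

/-- The Taylor polynomial of degree `k` of `g` at `c`. -/
noncomputable def taylorPolynomial (k : ℕ) (g : ℝ → ℝ) (c : ℝ) : ℝ[X] :=
  ∑ n ∈ Finset.range (k + 1), C (iteratedDeriv n g c / n.factorial) * (X - C c) ^ n

theorem natDegree_taylorPolynomial_le (k : ℕ) (g : ℝ → ℝ) (c : ℝ) :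
    (taylorPolynomial k g c).natDegree ≤ k := by
  refine natDegree_sum_le_of_forall_le _ _ fun n hn => (natDegree_C_mul_le _ _).trans ?_
  rw [natDegree_pow, natDegree_X_sub_C, mul_one]
  exact Nat.lt_succ_iff.mp (Finset.mem_range.mp hn)

theorem eval_iterate_derivative_taylorPolynomial_self {k l : ℕ} (hl : l ≤ k) (g : ℝ → ℝ)
    (c : ℝ) : (derivative^[l] (taylorPolynomial k g c)).eval c = iteratedDeriv l g c := by
  rw [taylorPolynomial, iterate_derivative_sum, eval_finsetSum, Finset.sum_eq_single l]
  · rw [iterate_derivative_C_mul, iterate_derivative_X_sub_pow]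
    simp [Nat.descFactorial_self, Nat.factorial_ne_zero]
  · intro n _ hn
    rw [iterate_derivative_C_mul, iterate_derivative_X_sub_pow]
    rcases lt_or_gt_of_ne hn with h | h
    · simp [Nat.descFactorial_eq_zero_iff_lt.mpr h]
    · simp [Nat.sub_ne_zero_of_lt h]
  · exact fun h => absurd (Finset.mem_range.mpr (Nat.lt_succ_of_le hl)) h

theorem eval_taylorPolynomial_eq_taylorWithinEval {k : ℕ} {g : ℝ → ℝ} (hg : ContDiff ℝ k g)
    {c x : ℝ} (hx : c ≠ x) :
    (taylorPolynomial k g c).eval x = taylorWithinEval g k (Set.uIcc c x) c x := by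
  rw [taylor_within_apply, taylorPolynomial, eval_finsetSum]
  refine Finset.sum_congr rfl fun n hn => ?_
  have hnk : (n : WithTop ℕ∞) ≤ k := by
    exact_mod_cast Nat.lt_succ_iff.mp (Finset.mem_range.mp hn)
  rw [iteratedDerivWithin_eq_iteratedDeriv (uniqueDiffOn_uIcc hx)
    (hg.of_le hnk).contDiffAt Set.left_mem_uIcc]
  simp only [eval_mul, eval_C, eval_pow, eval_sub, eval_X, smul_eq_mul]
  ring

theorem abs_sub_eval_taylorPolynomial_le {k : ℕ} {g : ℝ → ℝ} (hg : ContDiff ℝ (k + 1) g)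
    {B c x : ℝ} (hc : c ∈ Set.Icc (0 : ℝ) 1) (hx : x ∈ Set.Icc (0 : ℝ) 1)
    (hB : ∀ s ∈ Set.Icc (0 : ℝ) 1, |iteratedDeriv (k + 1) g s| ≤ B) :
    |g x - (taylorPolynomial k g c).eval x| ≤ B := by
  have hB0 : 0 ≤ B := (abs_nonneg _).trans (hB c hc)
  rcases eq_or_ne c x with rfl | hne
  · have hself : (taylorPolynomial k g c).eval c = g c := by
      simpa using eval_iterate_derivative_taylorPolynomial_self (Nat.zero_le k) g c
    simpa [hself] using hB0
  obtain ⟨y, hy, h⟩ := taylor_mean_remainder_lagrange_iteratedDeriv hne hg.contDiffOn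
  have hyB := hB y (Set.uIcc_subset_Icc hc hx ⟨hy.1.le, hy.2.le⟩)
  have hxc : |x - c| ≤ 1 := by
    rw [abs_le]; constructor <;> linarith [hx.1, hx.2, hc.1, hc.2]
  have hfactorial : (1 : ℝ) ≤ (k + 1).factorial := by exact_mod_cast Nat.factorial_pos (k + 1)
  rw [eval_taylorPolynomial_eq_taylorWithinEval (hg.of_le le_self_add) hne, h, abs_div, abs_mul,
    abs_pow, Nat.abs_cast]
  calc |iteratedDeriv (k + 1) g y| * |x - c| ^ (k + 1) / ((k + 1).factorial : ℝ)
      ≤ |iteratedDeriv (k + 1) g y| * |x - c| ^ (k + 1) := div_le_self (by positivity) hfactorial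
    _ ≤ |iteratedDeriv (k + 1) g y| :=
        mul_le_of_le_one_right (abs_nonneg _) (pow_le_one₀ (abs_nonneg _) hxc)
    _ ≤ B := hyB

theorem exists_radau_error (k : ℕ) : ∃ K : ℝ, 0 ≤ K ∧ ∀ g : ℝ → ℝ, ContDiff ℝ (k + 1) g →
    ∀ B : ℝ, (∀ s ∈ Set.Icc (0 : ℝ) 1, |iteratedDeriv (k + 1) g s| ≤ B) → ∀ l ≤ k,
      ∀ s ∈ Set.Icc (0 : ℝ) 1,
        |(derivative^[l] (radau k g)).eval s - iteratedDeriv l g s| ≤ K * B := by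
  obtain ⟨K, hK0, hK⟩ := exists_abs_radau_le k k
  refine ⟨K, hK0, fun g hg B hB l hl s hs => ?_⟩
  have h := hK (fun x => g x - (taylorPolynomial k g s).eval x) B
    (fun x hx => abs_sub_eval_taylorPolynomial_le hg hs hx hB) l hl s hs
  rwa [radau_sub k hg.continuous (taylorPolynomial k g s).continuous,
    radau_eval (natDegree_taylorPolynomial_le k g s), iterate_map_sub, eval_sub,
    eval_iterate_derivative_taylorPolynomial_self hl] at h

theorem iteratedDeriv_comp_affine {G : ℝ → ℝ} {l : ℕ} (hG : ContDiff ℝ l G) (y h s : ℝ) :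
    iteratedDeriv l (fun s => G (y + h * s)) s = h ^ l * iteratedDeriv l G (y + h * s) := by
  have hshift : ContDiff ℝ l fun z => G (y + z) := hG.comp (contDiff_const.add contDiff_id)
  rw [iteratedDeriv_comp_const_mul hshift h, iteratedDeriv_comp_const_add]

theorem exists_radau_error_cell (k : ℕ) : ∃ K : ℝ, 0 ≤ K ∧ ∀ G : ℝ → ℝ, ContDiff ℝ (k + 1) G →
    ∀ y h B : ℝ, 0 ≤ h → (∀ x ∈ Set.Icc y (y + h), |iteratedDeriv (k + 1) G x| ≤ B) → ∀ l ≤ k,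
      ∀ s ∈ Set.Icc (0 : ℝ) 1,
        |(derivative^[l] (radau k fun s => G (y + h * s))).eval s -
          h ^ l * iteratedDeriv l G (y + h * s)| ≤ K * B * h ^ (k + 1) := by
  obtain ⟨K, hK0, hK⟩ := exists_radau_error k
  refine ⟨K, hK0, fun G hG y h B hh hB l hl s hs => ?_⟩
  have hl' : (l : WithTop ℕ∞) ≤ k + 1 := by exact_mod_cast hl.trans k.le_succ
  rw [← iteratedDeriv_comp_affine (hG.of_le hl'), mul_assoc]
  refine hK (fun s => G (y + h * s))
    (hG.comp (contDiff_const.add (contDiff_const.mul contDiff_id))) _ (fun x hx => ?_) l hl s hs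
  have hG' : ContDiff ℝ (k + 1 : ℕ) G := by exact_mod_cast hG
  rw [iteratedDeriv_comp_affine hG', abs_mul, abs_pow, abs_of_nonneg hh, mul_comm]
  refine mul_le_mul_of_nonneg_right (hB _ ⟨?_, ?_⟩) (by positivity)
  · nlinarith [hx.1]
  · nlinarith [hx.2]

theorem hasDerivAt_sub_right {g : ℝ → ℝ} (hg : Differentiable ℝ g) (y t : ℝ) :
    HasDerivAt (fun t => g (y - t)) (-deriv g (y - t)) t :=
  (hg (y - t)).hasDerivAt.comp_const_sub y t

theorem hasDerivAt_integral_pow_mul {g : ℝ → ℝ} (hg : ContDiff ℝ 1 g) (j : ℕ) (y h t : ℝ) :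
    HasDerivAt (fun t => ∫ x in (0 : ℝ)..1, x ^ j * g (y + h * x - t))
      (∫ x in (0 : ℝ)..1, x ^ j * -deriv g (y + h * x - t)) t := by
  have hgc := hg.continuous
  have hdc : Continuous (deriv g) := hg.continuous_deriv le_rfl
  obtain ⟨B, hB⟩ := (isCompact_Icc.prod (isCompact_closedBall t 1)).exists_bound_of_continuousOn
    (f := fun p : ℝ × ℝ => p.1 ^ j * -deriv g (y + h * p.1 - p.2)) (s := Set.Icc (0 : ℝ) 1 ×ˢ _)
    (Continuous.continuousOn (by fun_prop))
  refine (intervalIntegral.hasDerivAt_integral_of_dominated_loc_of_deriv_le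
    (F := fun t x => x ^ j * g (y + h * x - t))
    (F' := fun t x => x ^ j * -deriv g (y + h * x - t)) (bound := fun _ => B)
    (Metric.ball_mem_nhds t one_pos)
    (.of_forall fun s => Continuous.aestronglyMeasurable (by fun_prop))
    (Continuous.intervalIntegrable (by fun_prop) _ _)
    (Continuous.aestronglyMeasurable (by fun_prop))
    (.of_forall fun x hx s hs => ?_) (continuous_const.intervalIntegrable _ _)
    (.of_forall fun x _ s _ =>
      (hasDerivAt_sub_right (hg.differentiable one_ne_zero) _ s).const_mul _)).2
  rw [Set.uIoc_of_le zero_le_one] at hx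
  exact hB (x, s) ⟨⟨hx.1.le, hx.2⟩, Metric.ball_subset_closedBall hs⟩

theorem hasDerivAt_coeff_radau (k : ℕ) {g : ℝ → ℝ} (hg : ContDiff ℝ 1 g) (n : ℕ) (y h t : ℝ) :
    HasDerivAt (fun t => (radau k fun s => g (y + h * s - t)).coeff n)
      ((radau k fun s => -deriv g (y + h * s - t)).coeff n) t := by
  obtain ⟨L, hL⟩ := exists_coeff_radau_eq k n
  simp only [hL]
  refine L.hasFDerivAt.comp_hasDerivAt t (HasDerivAt.prodMk ?_ ?_)
  · exact hasDerivAt_pi.mpr fun j => hasDerivAt_integral_pow_mul hg j y h t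
  · exact hasDerivAt_sub_right (hg.differentiable one_ne_zero) _ t

/-! ### The exact solution -/

theorem hasDerivAt_along_characteristic {u : ℝ → ℝ → ℝ} {c t : ℝ}
    (hu : DifferentiableAt ℝ (fun p : ℝ × ℝ => u p.1 p.2) (c + t, t)) :
    HasDerivAt (fun s => u (c + s) s)
      (deriv (fun s => u (c + t) s) t + deriv (fun y => u y t) (c + t)) t := by
  have hD := hu.hasFDerivAt
  have htime : HasDerivAt (fun s => u (c + t) s) _ t :=
    hD.comp_hasDerivAt (f := fun s => (c + t, s)) t
      ((hasDerivAt_const t (c + t)).prodMk (hasDerivAt_id t))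
  have hspace : HasDerivAt (fun y => u y t) _ (c + t) :=
    hD.comp_hasDerivAt (f := fun y => (y, t)) (c + t)
      ((hasDerivAt_id (c + t)).prodMk (hasDerivAt_const (c + t) t))
  have hdiag : HasDerivAt (fun s => u (c + s) s) _ t :=
    hD.comp_hasDerivAt (f := fun s => (c + s, s)) t
      (((hasDerivAt_id t).const_add c).prodMk (hasDerivAt_id t))
  rw [htime.deriv, hspace.deriv, ← map_add]
  simpa using hdiag

theorem eq_initial_of_transport {T : ℝ} {u : ℝ → ℝ → ℝ}
    (hu : ContDiffOn ℝ 1 (fun p : ℝ × ℝ => u p.1 p.2) (Set.univ ×ˢ Set.Icc 0 T))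
    (hpde : ∀ x : ℝ, ∀ t ∈ Set.Ioo 0 T,
      deriv (fun s => u x s) t + deriv (fun y => u y t) x = 0)
    (x : ℝ) {t : ℝ} (ht : t ∈ Set.Icc 0 T) : u x t = u (x - t) 0 := by
  rcases eq_or_lt_of_le ht.1 with rfl | ht0
  · rw [sub_zero]
  have hcont : ContinuousOn (fun s => u (x - t + s) s) (Set.Icc 0 t) :=
    hu.continuousOn.comp (f := fun s => (x - t + s, s)) (Continuous.continuousOn (by fun_prop))
      fun s hs => ⟨trivial, hs.1, hs.2.trans ht.2⟩
  have hderiv : ∀ s ∈ Set.Ioo 0 t, HasDerivAt (fun s => u (x - t + s) s) 0 s := fun s hs => by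
    have hs' : s ∈ Set.Ioo 0 T := ⟨hs.1, hs.2.trans_le ht.2⟩
    have hnhds : (Set.univ ×ˢ Set.Icc 0 T : Set (ℝ × ℝ)) ∈ nhds (x - t + s, s) :=
      prod_mem_nhds Filter.univ_mem (Icc_mem_nhds hs'.1 hs'.2)
    rw [← hpde (x - t + s) s hs']
    exact hasDerivAt_along_characteristic
      ((hu.contDiffAt hnhds).differentiableAt one_ne_zero)
  obtain ⟨c, -, hslope⟩ := exists_hasDerivAt_eq_slope _ _ ht0 hcont hderiv
  have hdiff := (div_eq_zero_iff.mp hslope.symm).resolve_right (sub_pos.mpr ht0).ne'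
  simpa [sub_eq_zero] using hdiff

theorem exists_iteratedDeriv_bound {g : ℝ → ℝ} {m : ℕ} (hg : ContDiff ℝ m g) (a b T : ℝ) :
    ∃ B : ℝ, 0 ≤ B ∧ ∀ l ≤ m, ∀ x ∈ Set.Icc a b, ∀ t ∈ Set.Icc 0 T,
      |iteratedDeriv l g (x - t)| ≤ B := by
  obtain ⟨B, hB⟩ := isCompact_Icc.exists_bound_of_continuousOn (s := Set.Icc (a - T) b)
    (f := fun s => ∑ l ∈ Finset.range (m + 1), |iteratedDeriv l g s|)
    (Continuous.continuousOn <| continuous_finsetSum _ fun l hl =>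
      (hg.continuous_iteratedDeriv l
        (by exact_mod_cast Nat.lt_succ_iff.mp (Finset.mem_range.mp hl))).abs)
  refine ⟨|B|, abs_nonneg B, fun l hl x hx t ht => ?_⟩
  refine le_trans ?_ ((le_abs_self _).trans ((hB (x - t)
    ⟨by linarith [hx.1, ht.2], by linarith [hx.2, ht.1]⟩).trans (le_abs_self B)))
  exact Finset.single_le_sum (f := fun l => |iteratedDeriv l g (x - t)|)
    (fun _ _ => abs_nonneg _) (Finset.mem_range.mpr (Nat.lt_succ_of_le hl))

/-! ### The mesh and the reference cell -/

theorem meshSize_pos {a b : ℝ} (hab : a < b) (N : ℕ) [NeZero N] : 0 < meshSize a b N :=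
  div_pos (sub_pos.mpr hab) (Nat.cast_pos.mpr (NeZero.pos N))

theorem card_mul_meshSize (a b : ℝ) (N : ℕ) [NeZero N] : N * meshSize a b N = b - a :=
  mul_div_cancel₀ _ (Nat.cast_ne_zero.mpr (NeZero.ne N))

theorem meshSize_le {a b : ℝ} (hab : a < b) (N : ℕ) [NeZero N] : meshSize a b N ≤ b - a :=
  div_le_self (sub_pos.mpr hab).le (by exact_mod_cast NeZero.pos N)

theorem xR_eq (a b : ℝ) {N : ℕ} (i : Fin N) : xR a b i = xL a b i + meshSize a b N := by
  rw [xR, xL]; ring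

theorem Icc_cell_subset {a b : ℝ} (hab : a < b) {N : ℕ} [NeZero N] (i : Fin N) :
    Set.Icc (xL a b i) (xL a b i + meshSize a b N) ⊆ Set.Icc a b := by
  have hh := (meshSize_pos hab N).le
  have hi : ((i : ℕ) + 1 : ℝ) * meshSize a b N ≤ N * meshSize a b N :=
    mul_le_mul_of_nonneg_right (by exact_mod_cast i.2) hh
  refine Set.Icc_subset_Icc (le_add_of_nonneg_right (by positivity)) ?_
  rw [← xR_eq, xR]
  linarith [card_mul_meshSize a b N]

theorem integral_cell (a b : ℝ) {N : ℕ} (i : Fin N) (F : ℝ → ℝ) :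
    ∫ x in (xL a b i)..(xR a b i), F x =
      meshSize a b N * ∫ s in (0 : ℝ)..1, F (xL a b i + meshSize a b N * s) := by
  rw [← smul_eq_mul, intervalIntegral.smul_integral_comp_add_mul, mul_zero, mul_one, add_zero,
    xR_eq]

/-- The pull-back of a polynomial on cell `i` to the reference cell `[0,1]`. -/
noncomputable def toRef (a b : ℝ) {N : ℕ} (i : Fin N) : ℝ[X] →ₐ[ℝ] ℝ[X] :=
  aeval (C (xL a b i) + C (meshSize a b N) * X)

theorem toRef_apply (a b : ℝ) {N : ℕ} (i : Fin N) (p : ℝ[X]) :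
    toRef a b i p = p.comp (C (xL a b i) + C (meshSize a b N) * X) :=
  rfl

theorem eval_toRef (a b : ℝ) {N : ℕ} (i : Fin N) (p : ℝ[X]) (s : ℝ) :
    (toRef a b i p).eval s = p.eval (xL a b i + meshSize a b N * s) := by
  simp [toRef_apply]

theorem eval_zero_toRef (a b : ℝ) {N : ℕ} (i : Fin N) (p : ℝ[X]) :
    (toRef a b i p).eval 0 = p.eval (xL a b i) := by
  rw [eval_toRef, mul_zero, add_zero]

theorem eval_one_toRef (a b : ℝ) {N : ℕ} (i : Fin N) (p : ℝ[X]) :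
    (toRef a b i p).eval 1 = p.eval (xR a b i) := by
  rw [eval_toRef, mul_one, xR_eq]

theorem natDegree_toRef_le (a b : ℝ) {N : ℕ} (i : Fin N) (p : ℝ[X]) :
    (toRef a b i p).natDegree ≤ p.natDegree := by
  have hlinear : (C (xL a b i) + C (meshSize a b N) * X : ℝ[X]).natDegree ≤ 1 := by
    compute_degree
  exact natDegree_comp_le.trans (mul_le_of_le_one_right' hlinear)

theorem iterate_derivative_toRef (a b : ℝ) {N : ℕ} (i : Fin N) (p : ℝ[X]) (l : ℕ) :
    derivative^[l] (toRef a b i p) =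
      C (meshSize a b N ^ l) * toRef a b i (derivative^[l] p) := by
  induction l with
  | zero => simp
  | succ l ih =>
    rw [Function.iterate_succ_apply', ih, Function.iterate_succ_apply']
    simp only [toRef_apply, derivative_C_mul, derivative_comp, derivative_add, derivative_C,
      derivative_X, zero_add, mul_one, pow_succ, C_mul, mul_assoc]

theorem derivative_toRef (a b : ℝ) {N : ℕ} (i : Fin N) (p : ℝ[X]) :
    derivative (toRef a b i p) = C (meshSize a b N) * toRef a b i (derivative p) := by
  simpa using iterate_derivative_toRef a b i p 1

theorem exists_toRef_eq {a b : ℝ} {N : ℕ} (hh : meshSize a b N ≠ 0) (i : Fin N) (q : ℝ[X]) :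
    ∃ φ : ℝ[X], φ.natDegree ≤ q.natDegree ∧ toRef a b i φ = q := by
  refine ⟨q.comp (C (meshSize a b N)⁻¹ * (X - C (xL a b i))), ?_, ?_⟩
  · have hlinear : (C (meshSize a b N)⁻¹ * (X - C (xL a b i)) : ℝ[X]).natDegree ≤ 1 := by
      compute_degree
    exact natDegree_comp_le.trans (mul_le_of_le_one_right' hlinear)
  · refine Polynomial.funext fun s => ?_
    rw [eval_toRef]
    simp only [eval_comp, eval_mul, eval_C, eval_sub, eval_X, add_sub_cancel_left,
      inv_mul_cancel_left₀ hh]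

/-- The weight `ν_i` in the reference variable `s = (x - x_{i-1/2}) / h ∈ [0,1]`. -/
noncomputable def nuRef (s : ℝ) : ℝ := 1 - (2 * s - 1) ^ 2

theorem continuous_nuRef : Continuous nuRef := by unfold nuRef; fun_prop

theorem nuRef_mem_Icc {s : ℝ} (hs : s ∈ Set.Icc (0 : ℝ) 1) : nuRef s ∈ Set.Icc (0 : ℝ) 1 := by
  unfold nuRef
  constructor <;> nlinarith [hs.1, hs.2, sq_nonneg (2 * s - 1)]

theorem nu_eq_nuRef {a b : ℝ} {N : ℕ} (hh : meshSize a b N ≠ 0) (i : Fin N) (s : ℝ) :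
    nu a b i (xL a b i + meshSize a b N * s) = nuRef s := by
  rw [nu, nuRef, xC, xR_eq]
  congr 2
  field_simp
  ring

/-- The viscous form `(p, q) ↦ ∫ ν p' q'` on the reference cell. -/
noncomputable def viscousForm (p q : ℝ[X]) : ℝ :=
  ∫ s in (0 : ℝ)..1, nuRef s * p.derivative.eval s * q.derivative.eval s

theorem viscousForm_sub_left (p₁ p₂ q : ℝ[X]) :
    viscousForm (p₁ - p₂) q = viscousForm p₁ q - viscousForm p₂ q := by
  have hν := continuous_nuRef
  simp only [viscousForm]
  rw [← intervalIntegral.integral_sub (Continuous.intervalIntegrable (by fun_prop) _ _)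
    (Continuous.intervalIntegrable (by fun_prop) _ _)]
  simp only [derivative_sub, eval_sub, mul_sub, sub_mul]

theorem viscousForm_self_nonneg (p : ℝ[X]) : 0 ≤ viscousForm p p :=
  intervalIntegral.integral_nonneg zero_le_one fun s hs => by
    rw [mul_assoc]
    exact mul_nonneg (nuRef_mem_Icc hs).1 (mul_self_nonneg _)

/-! ### The scheme on the reference cell -/

/-- `Wd` is the time derivative which the upwind scheme with cell size `h`, viscosity `s` and
inflow value `um` assigns to the state `W` on the reference cell. -/
def SatisfiesCellScheme (k : ℕ) (h s um : ℝ) (W Wd : ℝ[X]) : Prop :=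
  ∀ q : ℝ[X], q.natDegree ≤ k → h * pairing Wd q =
    pairing W q.derivative - W.eval 1 * q.eval 1 + um * q.eval 0 - s * viscousForm W q

theorem flux_linearSquare (um up : ℝ) : flux linearSquare um up = um := by
  have hspeed : waveSpeed linearSquare um up = 1 := by
    simp [waveSpeed, linearSquare, Set.Nonempty.image_const Set.nonempty_uIcc]
  rw [flux, fluxC, fluxD, hspeed]
  simp only [linearSquare]
  ring

theorem coeffA_linearSquare (s : ℝ) : coeffA linearSquare s = 1 := by
  have hU : deriv linearSquare.U = id := deriv_linearSquare_U
  rw [coeffA, hU, deriv_id, inv_one]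

theorem schemeRHS_linearSquare {a b : ℝ} (bc : BoundaryCondition) {k N : ℕ}
    [NeZero N] (hh : meshSize a b N ≠ 0) (C c₀ : ℝ) (w : Fin N → ℝ[X]) (i : Fin N)
    (hw : (w i).natDegree ≤ k) (φ : ℝ[X]) :
    schemeRHS linearSquare bc k C c₀ a b w i φ =
      pairing (toRef a b i (w i)) (toRef a b i φ).derivative
        - (toRef a b i (w i)).eval 1 * (toRef a b i φ).eval 1
        + outerL bc a b w i * (toRef a b i φ).eval 0
        - sigma linearSquare bc k C c₀ a b w i / meshSize a b N *
          viscousForm (toRef a b i (w i)) (toRef a b i φ) := by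
  have hf : ∀ s, linearSquare.f s = s := fun _ => rfl
  rw [schemeRHS, integral_cell, integral_cell, flux_linearSquare, flux_linearSquare,
    derivative_entropyVar hh w i hw, pairing_apply, viscousForm, eval_one_toRef, eval_one_toRef,
    eval_zero_toRef, innerR, ← intervalIntegral.integral_const_mul,
    ← intervalIntegral.integral_const_mul, ← intervalIntegral.integral_const_mul,
    ← intervalIntegral.integral_const_mul]
  simp only [nu_eq_nuRef hh, coeffA_linearSquare, derivative_toRef, eval_mul, eval_C, eval_toRef,
    hf]
  congr 2
  · congr 2
    funext s; ring
  · funext s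
    field_simp

theorem IsSolution.satisfiesCellScheme {a b T : ℝ} (hab : a < b) {bc : BoundaryCondition}
    {k N : ℕ} [NeZero N] {C c₀ : ℝ} {u₀ : ℝ → ℝ} {uh : ℝ → Fin N → ℝ[X]}
    (h : IsSolution linearSquare bc k C c₀ a b T u₀ uh) {t : ℝ} (ht : t ∈ Set.Icc 0 T)
    (i : Fin N) {Wd : ℝ[X]} (hWd : ∀ s,
      derivWithin (fun τ => (toRef a b i (uh τ i)).eval s) (Set.Icc 0 T) t = Wd.eval s) :
    SatisfiesCellScheme k (meshSize a b N)
      (sigma linearSquare bc k C c₀ a b (uh t) i / meshSize a b N)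
      (outerL bc a b (uh t) i) (toRef a b i (uh t i)) Wd := fun q hq => by
  have hh := (meshSize_pos hab N).ne'
  obtain ⟨φ, hφ, rfl⟩ := exists_toRef_eq hh i q
  rw [← schemeRHS_linearSquare bc hh C c₀ (uh t) i (h.mem t ht i) φ,
    ← h.scheme t ht i φ (hφ.trans hq), integral_cell]
  simp only [pairing_apply, ← hWd, eval_toRef]

/-! ### Values at the cell interfaces -/

theorem val_add_one_eq {N : ℕ} [NeZero N] (i : Fin N) :
    ((i + 1 : Fin N) : ℕ) = if (i : ℕ) + 1 = N then 0 else (i : ℕ) + 1 := by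
  obtain ⟨n, rfl⟩ := Nat.exists_eq_succ_of_ne_zero (NeZero.ne N)
  rw [Fin.val_add_one]
  simp [Fin.ext_iff]

theorem xR_eq_of_val_add_one_eq (a b : ℝ) {N : ℕ} [NeZero N] {i : Fin N}
    (hi : (i : ℕ) + 1 = N) : xR a b i = b := by
  have hi' : ((i : ℕ) + 1 : ℝ) = N := by exact_mod_cast hi
  rw [xR, hi', card_mul_meshSize, add_sub_cancel]

theorem xL_add_one_of_val_add_one_eq (a b : ℝ) {N : ℕ} [NeZero N] {i : Fin N}
    (hi : (i : ℕ) + 1 = N) : xL a b (i + 1) = a := by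
  rw [xL, val_add_one_eq, if_pos hi, Nat.cast_zero, zero_mul, add_zero]

theorem xL_add_one_of_val_add_one_ne (a b : ℝ) {N : ℕ} [NeZero N] {i : Fin N}
    (hi : (i : ℕ) + 1 ≠ N) : xL a b (i + 1) = xR a b i := by
  rw [xL, xR, val_add_one_eq, if_neg hi, Nat.cast_add, Nat.cast_one]

/-- The boundary values of `D` are those of a function subject to the boundary condition `bc`:
equal at both ends in the periodic case, zero in the compactly supported one. -/
def BoundaryCompatible (bc : BoundaryCondition) (a b : ℝ) (D : ℝ → ℝ) : Prop :=
  match bc with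
  | .periodic => D a = D b
  | .compactSupport => D a = 0 ∧ D b = 0

theorem BoundaryCompatible.apply_left_eq {bc : BoundaryCondition} {a b : ℝ} {D : ℝ → ℝ}
    (hD : BoundaryCompatible bc a b D) : D a = D b := by
  cases bc
  · exact hD
  · exact hD.1.trans hD.2.symm

theorem BoundaryCompatible.apply_xL_add_one {bc : BoundaryCondition} {a b : ℝ} {D : ℝ → ℝ}
    (hD : BoundaryCompatible bc a b D) {N : ℕ} [NeZero N] (i : Fin N) :
    D (xL a b (i + 1)) = D (xR a b i) := by
  by_cases hi : (i : ℕ) + 1 = N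
  · rw [xR_eq_of_val_add_one_eq a b hi, xL_add_one_of_val_add_one_eq a b hi, hD.apply_left_eq]
  · rw [xL_add_one_of_val_add_one_ne a b hi]

theorem abs_sub_outerL_add_one_le {bc : BoundaryCondition} {a b : ℝ} {D : ℝ → ℝ}
    (hD : BoundaryCompatible bc a b D) {N : ℕ} [NeZero N] (w : Fin N → ℝ[X]) (i : Fin N) :
    |D (xL a b (i + 1)) - outerL bc a b w (i + 1)| ≤ |D (xR a b i) - innerR a b w i| := by
  cases bc
  · rw [hD.apply_xL_add_one, outerL, add_sub_cancel_right]
  · by_cases hi : (i : ℕ) + 1 = N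
    · simp only [outerL, val_add_one_eq, if_pos hi, if_true,
        xL_add_one_of_val_add_one_eq a b hi, hD.1, sub_zero, abs_zero, abs_nonneg]
    · simp only [hD.apply_xL_add_one, outerL, val_add_one_eq, if_neg hi, Nat.succ_ne_zero,
        if_false, add_sub_cancel_right, le_refl]

theorem abs_sub_outerL_le {bc : BoundaryCondition} {a b : ℝ} {D : ℝ → ℝ}
    (hD : BoundaryCompatible bc a b D) {N : ℕ} [NeZero N] (w : Fin N → ℝ[X]) (i : Fin N) :
    |D (xL a b i) - outerL bc a b w i| ≤ |D (xR a b (i - 1)) - innerR a b w (i - 1)| := by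
  simpa only [sub_add_cancel] using abs_sub_outerL_add_one_le hD w (i - 1)

theorem abs_sub_outerR_le {bc : BoundaryCondition} {a b : ℝ} {D : ℝ → ℝ}
    (hD : BoundaryCompatible bc a b D) {N : ℕ} [NeZero N] (w : Fin N → ℝ[X]) (i : Fin N) :
    |D (xR a b i) - outerR bc a b w i| ≤ |D (xL a b (i + 1)) - innerL a b w (i + 1)| := by
  cases bc
  · rw [hD.apply_xL_add_one, outerR]
  · by_cases hi : (i : ℕ) + 1 = N
    · simp only [outerR, if_pos hi, xR_eq_of_val_add_one_eq a b hi, hD.2, sub_zero, abs_zero,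
        abs_nonneg]
    · simp only [hD.apply_xL_add_one, outerR, if_neg hi, le_refl]

theorem IsSmoothSolution.boundaryCompatible {f : ℝ → ℝ} {a b T : ℝ} {bc : BoundaryCondition}
    {u : ℝ → ℝ → ℝ} (hu : IsSmoothSolution f a b T bc u) {t : ℝ} (ht : t ∈ Set.Icc 0 T) (l : ℕ) :
    BoundaryCompatible bc a b (iteratedDeriv l fun x => u x t) := by
  have hboundary := hu.boundary
  cases bc
  · have hperiodic : (fun x => u (x + (b - a)) t) = fun x => u x t :=
      funext fun x => hboundary x t ht
    have hshift := congrFun (iteratedDeriv_comp_add_const l (fun x => u x t) (b - a)) a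
    rwa [hperiodic, add_sub_cancel] at hshift
  · have hzero : ∀ x ∉ Set.Ioo a b, iteratedDeriv l (fun x => u x t) x = 0 := fun x hx => by
      have hx' := notMem_tsupport_iff_eventuallyEq.mp fun h => hx (hboundary t ht h)
      rw [hx'.iteratedDeriv_eq l]
      simp [Pi.zero_def]
    exact ⟨hzero a (by simp), hzero b (by simp)⟩

/-! ### Bounds for the viscosity parameter -/

theorem sigmaJump_linearSquare {a b : ℝ} (hab : a < b) (bc : BoundaryCondition) (k : ℕ) (c₀ : ℝ)
    {N : ℕ} [NeZero N] (w : Fin N → ℝ[X]) (i : Fin N) :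
    sigmaJump linearSquare bc k c₀ a b w i = c₀ *
      (meshSize a b N * jumpNorm bc a b w 0 i + ∑ l ∈ Finset.Icc 1 k,
        (l : ℝ) * (l + 1) * meshSize a b N ^ (l + 1) * jumpNorm bc a b w l i) := by
  have hcell : (Set.Icc (xL a b i) (xR a b i)).Nonempty := by
    rw [xR_eq]
    exact Set.nonempty_Icc.mpr (le_add_of_nonneg_right (meshSize_pos hab N).le)
  have hspeed :
      sSup ((fun x => |deriv linearSquare.f ((w i).eval x)|) '' Set.Icc (xL a b i) (xR a b i)) =
        1 := by
    simp [linearSquare, hcell.image_const]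
  rw [sigmaJump, hspeed, mul_one]

theorem jumpNorm_nonneg (bc : BoundaryCondition) (a b : ℝ) {N : ℕ} [NeZero N] (w : Fin N → ℝ[X])
    (l : ℕ) (i : Fin N) : 0 ≤ jumpNorm bc a b w l i := by
  unfold jumpNorm; positivity

theorem sigmaJump_linearSquare_nonneg {a b : ℝ} (hab : a < b) (bc : BoundaryCondition) (k : ℕ)
    {c₀ : ℝ} (hc₀ : 0 ≤ c₀) {N : ℕ} [NeZero N] (w : Fin N → ℝ[X]) (i : Fin N) :
    0 ≤ sigmaJump linearSquare bc k c₀ a b w i := by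
  have hh := (meshSize_pos hab N).le
  have hjump := fun l => jumpNorm_nonneg bc a b w l i
  rw [sigmaJump_linearSquare hab]
  exact mul_nonneg hc₀ (add_nonneg (mul_nonneg hh (hjump 0))
    (Finset.sum_nonneg fun l _ => mul_nonneg (by positivity) (hjump l)))

theorem sigma_linearSquare_nonneg {a b : ℝ} (hab : a < b) (bc : BoundaryCondition) (k : ℕ)
    (C : ℝ) {c₀ : ℝ} (hc₀ : 0 ≤ c₀) {N : ℕ} [NeZero N] (w : Fin N → ℝ[X]) (i : Fin N) :
    0 ≤ sigma linearSquare bc k C c₀ a b w i :=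
  (sigmaJump_linearSquare_nonneg hab bc k hc₀ w i).trans (le_max_left _ _)

theorem sigma_le_max_mul_sigmaJump {a b : ℝ} (hab : a < b) (bc : BoundaryCondition) (k : ℕ)
    (C : ℝ) {c₀ : ℝ} (hc₀ : 0 ≤ c₀) {N : ℕ} [NeZero N] (w : Fin N → ℝ[X]) (i : Fin N) :
    sigma linearSquare bc k C c₀ a b w i ≤
      max 1 C * sigmaJump linearSquare bc k c₀ a b w i := by
  rw [max_mul_of_nonneg _ _ (sigmaJump_linearSquare_nonneg hab bc k hc₀ w i), one_mul]
  exact max_le_max le_rfl (min_le_right _ _)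

theorem abs_innerL_sub_outerL_le {bc : BoundaryCondition} {a b : ℝ} {D : ℝ → ℝ}
    (hD : BoundaryCompatible bc a b D) {N : ℕ} [NeZero N] (w : Fin N → ℝ[X]) (i : Fin N) :
    |innerL a b w i - outerL bc a b w i| ≤
      |D (xL a b i) - innerL a b w i| + |D (xR a b (i - 1)) - innerR a b w (i - 1)| := by
  refine (abs_sub_le _ (D (xL a b i)) _).trans (add_le_add ?_ (abs_sub_outerL_le hD w i))
  rw [abs_sub_comm]

theorem abs_outerR_sub_innerR_le {bc : BoundaryCondition} {a b : ℝ} {D : ℝ → ℝ}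
    (hD : BoundaryCompatible bc a b D) {N : ℕ} [NeZero N] (w : Fin N → ℝ[X]) (i : Fin N) :
    |outerR bc a b w i - innerR a b w i| ≤
      |D (xL a b (i + 1)) - innerL a b w (i + 1)| + |D (xR a b i) - innerR a b w i| := by
  refine (abs_sub_le _ (D (xR a b i)) _).trans (add_le_add ?_ le_rfl)
  rw [abs_sub_comm]
  exact abs_sub_outerR_le hD w i

theorem pow_mul_jumpNorm_le {bc : BoundaryCondition} {a b : ℝ} {D : ℝ → ℝ}
    (hD : BoundaryCompatible bc a b D) {l N : ℕ} [NeZero N] (hh : 0 ≤ meshSize a b N)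
    (w : Fin N → ℝ[X]) (e : Fin N → ℝ)
    (he : ∀ i, ∀ s ∈ Set.Icc (0 : ℝ) 1, |meshSize a b N ^ l * D (xL a b i + meshSize a b N * s)
      - (derivative^[l] (toRef a b i (w i))).eval s| ≤ e i) (i : Fin N) :
    meshSize a b N ^ l * jumpNorm bc a b w l i ≤ 2 * (e (i - 1) + e i + e (i + 1)) := by
  let dw : Fin N → ℝ[X] := fun j => derivative^[l] (w j)
  have hpow : 0 ≤ meshSize a b N ^ l := pow_nonneg hh l
  have hcell : ∀ i, ∀ s ∈ Set.Icc (0 : ℝ) 1, meshSize a b N ^ l *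
      |D (xL a b i + meshSize a b N * s) - (toRef a b i (dw i)).eval s| ≤ e i := fun i s hs => by
    simpa only [iterate_derivative_toRef, eval_mul, eval_C, ← mul_sub, abs_mul,
      abs_of_nonneg hpow] using he i s hs
  have hleft : ∀ i, meshSize a b N ^ l * |D (xL a b i) - innerL a b dw i| ≤ e i := fun i => by
    simpa only [eval_zero_toRef, mul_zero, add_zero, innerL] using hcell i 0 (by simp)
  have hright : ∀ i, meshSize a b N ^ l * |D (xR a b i) - innerR a b dw i| ≤ e i := fun i => by
    simpa only [eval_one_toRef, mul_one, ← xR_eq, innerR] using hcell i 1 (by simp)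
  have he0 : ∀ i, 0 ≤ e i := fun i => (mul_nonneg hpow (abs_nonneg _)).trans (hleft i)
  calc meshSize a b N ^ l * jumpNorm bc a b w l i
      = meshSize a b N ^ l * (|innerL a b dw i - outerL bc a b dw i| +
          |outerR bc a b dw i - innerR a b dw i|) := rfl
    _ ≤ meshSize a b N ^ l *
          (|D (xL a b i) - innerL a b dw i| + |D (xR a b (i - 1)) - innerR a b dw (i - 1)| +
          (|D (xL a b (i + 1)) - innerL a b dw (i + 1)| + |D (xR a b i) - innerR a b dw i|)) :=
        mul_le_mul_of_nonneg_left (add_le_add (abs_innerL_sub_outerL_le hD dw i)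
          (abs_outerR_sub_innerR_le hD dw i)) hpow
    _ ≤ e i + e (i - 1) + (e (i + 1) + e i) := by
        simp only [mul_add]
        exact add_le_add (add_le_add (hleft i) (hright (i - 1)))
          (add_le_add (hleft (i + 1)) (hright i))
    _ ≤ 2 * (e (i - 1) + e i + e (i + 1)) := by
        linarith [he0 (i - 1), he0 (i + 1)]

theorem sigma_div_meshSize_le {a b : ℝ} (hab : a < b) {bc : BoundaryCondition} {k : ℕ}
    (C : ℝ) {c₀ : ℝ} (hc₀ : 0 ≤ c₀) {G : ℝ → ℝ}
    (hG : ∀ l ≤ k, BoundaryCompatible bc a b (iteratedDeriv l G)) {N : ℕ} [NeZero N]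
    (w : Fin N → ℝ[X]) (e : Fin N → ℝ)
    (he : ∀ i, ∀ l ≤ k, ∀ s ∈ Set.Icc (0 : ℝ) 1, |meshSize a b N ^ l * (iteratedDeriv l G
      (xL a b i + meshSize a b N * s)) - (derivative^[l] (toRef a b i (w i))).eval s| ≤ e i)
    (i : Fin N) :
    sigma linearSquare bc k C c₀ a b w i / meshSize a b N ≤
      max 1 C * (c₀ * ((1 + ∑ l ∈ Finset.Icc 1 k, (l : ℝ) * (l + 1)) *
        (2 * (e (i - 1) + e i + e (i + 1))))) := by
  have hh := meshSize_pos hab N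
  have hjump : ∀ l ≤ k, meshSize a b N ^ l * jumpNorm bc a b w l i ≤
      2 * (e (i - 1) + e i + e (i + 1)) :=
    fun l hl => pow_mul_jumpNorm_le (hG l hl) hh.le w e (fun i => he i l hl) i
  have hsplit : sigmaJump linearSquare bc k c₀ a b w i / meshSize a b N =
      c₀ * (meshSize a b N ^ 0 * jumpNorm bc a b w 0 i + ∑ l ∈ Finset.Icc 1 k,
        (l : ℝ) * (l + 1) * (meshSize a b N ^ l * jumpNorm bc a b w l i)) := by
    rw [sigmaJump_linearSquare hab, div_eq_iff hh.ne', mul_assoc, add_mul, Finset.sum_mul]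
    congr 2
    · ring
    · exact Finset.sum_congr rfl fun l _ => by ring
  calc sigma linearSquare bc k C c₀ a b w i / meshSize a b N
      ≤ max 1 C * (sigmaJump linearSquare bc k c₀ a b w i / meshSize a b N) := by
        rw [← mul_div_assoc]
        exact div_le_div_of_nonneg_right (sigma_le_max_mul_sigmaJump hab bc k C hc₀ w i) hh.le
    _ ≤ _ := by
        rw [hsplit, add_mul, one_mul, Finset.sum_mul]
        exact mul_le_mul_of_nonneg_left (mul_le_mul_of_nonneg_left (add_le_add
          (hjump 0 k.zero_le) (Finset.sum_le_sum fun l hl => mul_le_mul_of_nonneg_left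
            (hjump l (Finset.mem_Icc.mp hl).2) (by positivity))) hc₀)
          (zero_le_one.trans (le_max_left 1 C))

/-! ### The energy estimate on the reference cell -/

theorem pairing_derivative_self (p : ℝ[X]) :
    pairing p p.derivative = (p.eval 1 ^ 2 - p.eval 0 ^ 2) / 2 := by
  rw [pairing_apply,
    intervalIntegral.integral_eq_sub_of_hasDerivAt (f := fun x => p.eval x ^ 2 / 2)]
  · ring
  · intro x _
    refine (((p.hasDerivAt x).pow 2).div_const 2).congr_deriv ?_
    ring
  · exact Continuous.intervalIntegrable (by fun_prop) _ _

theorem integral_mul_derivative_eq_pairing_radau {k : ℕ} {g : ℝ → ℝ} (hg : Continuous g)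
    {q : ℝ[X]} (hq : q.natDegree ≤ k) :
    ∫ x in (0 : ℝ)..1, g x * q.derivative.eval x = pairing (radau k g) q.derivative := by
  rcases Nat.eq_zero_or_pos q.natDegree with h0 | hpos
  · simp [pairing_apply, derivative_of_natDegree_zero h0]
  · exact (integral_radau_mul hg ((natDegree_derivative_lt hpos.ne').trans_le hq)).symm

theorem mul_integral_eq_of_transport {h : ℝ} {g gt : ℝ → ℝ} (hg : ContDiff ℝ 1 g)
    (hgt : ∀ x, h * gt x = -deriv g x) (q : ℝ[X]) :
    h * ∫ x in (0 : ℝ)..1, gt x * q.eval x =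
      (∫ x in (0 : ℝ)..1, g x * q.derivative.eval x) - g 1 * q.eval 1 + g 0 * q.eval 0 := by
  have hg' : Continuous (deriv g) := hg.continuous_deriv le_rfl
  have hparts := intervalIntegral.integral_mul_deriv_eq_deriv_mul (a := 0) (b := 1)
    (fun x _ => (hg.differentiable one_ne_zero x).hasDerivAt) (fun x _ => q.hasDerivAt x)
    (hg'.intervalIntegrable _ _) (q.derivative.continuous.intervalIntegrable _ _)
  rw [hparts, ← intervalIntegral.integral_const_mul]
  simp only [← mul_assoc, hgt, neg_mul, intervalIntegral.integral_neg]
  ring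

theorem SatisfiesCellScheme.error_equation {k : ℕ} {h s um : ℝ} {W Wd : ℝ[X]}
    (hW : SatisfiesCellScheme k h s um W Wd) {g gt : ℝ → ℝ} (hg : ContDiff ℝ 1 g)
    (hgt : ∀ x, h * gt x = -deriv g x) {q : ℝ[X]} (hq : q.natDegree ≤ k) :
    h * ((∫ x in (0 : ℝ)..1, gt x * q.eval x) - pairing Wd q) =
      pairing (radau k g - W) q.derivative - (radau k g - W).eval 1 * q.eval 1
        + (g 0 - um) * q.eval 0 + s * viscousForm W q := by
  rw [mul_sub, mul_integral_eq_of_transport hg hgt, hW q hq,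
    integral_mul_derivative_eq_pairing_radau hg.continuous hq, eval_sub, eval_one_radau,
    LinearMap.map_sub₂]
  ring

theorem SatisfiesCellScheme.energy_le {k : ℕ} {h s um : ℝ} {W Wd : ℝ[X]}
    (hscheme : SatisfiesCellScheme k h s um W Wd) (hW : W.natDegree ≤ k) (hs : 0 ≤ s)
    {g gt : ℝ → ℝ} (hg : ContDiff ℝ 1 g) (hgtc : Continuous gt)
    (hgt : ∀ x, h * gt x = -deriv g x) :
    h * pairing (radau k gt - Wd) (radau k g - W) ≤
      h * (∫ x in (0 : ℝ)..1, ((radau k gt).eval x - gt x) * (radau k g - W).eval x)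
        + ((g 0 - um) ^ 2 - (radau k g - W).eval 1 ^ 2) / 2
        + s * viscousForm (radau k g) (radau k g - W) := by
  have hξ : (radau k g - W).natDegree ≤ k :=
    (natDegree_sub_le _ _).trans (max_le (natDegree_radau_le k g) hW)
  have hequation := hscheme.error_equation hg hgt hξ
  have hdissipation := mul_nonneg hs (viscousForm_self_nonneg (radau k g - W))
  rw [viscousForm_sub_left, mul_sub] at hdissipation
  have hprojection : ∫ x in (0 : ℝ)..1, ((radau k gt).eval x - gt x) * (radau k g - W).eval x =
      pairing (radau k gt) (radau k g - W) -
        ∫ x in (0 : ℝ)..1, gt x * (radau k g - W).eval x := by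
    rw [pairing_apply, ← intervalIntegral.integral_sub
      (Continuous.intervalIntegrable (by fun_prop) _ _)
      (Continuous.intervalIntegrable (by fun_prop) _ _)]
    simp only [sub_mul]
  rw [pairing_derivative_self] at hequation
  rw [hprojection, LinearMap.map_sub₂]
  linarith [sq_nonneg (g 0 - um - (radau k g - W).eval 0)]

/-! ### Projection errors on the mesh -/

/-- The Gauss–Radau projection of `G` on cell `i`, in the reference variable. -/
noncomputable def cellProj (k : ℕ) (a b : ℝ) {N : ℕ} (i : Fin N) (G : ℝ → ℝ) : ℝ[X] :=
  radau k fun s => G (xL a b i + meshSize a b N * s)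

theorem natDegree_cellProj_le (k : ℕ) (a b : ℝ) {N : ℕ} (i : Fin N) (G : ℝ → ℝ) :
    (cellProj k a b i G).natDegree ≤ k :=
  natDegree_radau_le k _

theorem eval_one_cellProj (k : ℕ) (a b : ℝ) {N : ℕ} (i : Fin N) (G : ℝ → ℝ) :
    (cellProj k a b i G).eval 1 = G (xR a b i) := by
  rw [cellProj, eval_one_radau, mul_one, xR_eq]

theorem add_meshSize_mul_mem_Icc {a b : ℝ} (hab : a < b) {N : ℕ} [NeZero N] (i : Fin N) {s : ℝ}
    (hs : s ∈ Set.Icc (0 : ℝ) 1) : xL a b i + meshSize a b N * s ∈ Set.Icc a b := by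
  have hh := (meshSize_pos hab N).le
  exact Icc_cell_subset hab i ⟨le_add_of_nonneg_right (mul_nonneg hh hs.1),
    add_le_add_right (mul_le_of_le_one_right hh hs.2) _⟩

theorem exists_cellProj_error (k : ℕ) {a b : ℝ} (hab : a < b) : ∃ K : ℝ, 0 ≤ K ∧
    ∀ G : ℝ → ℝ, ContDiff ℝ (k + 1) G → ∀ B : ℝ,
    (∀ x ∈ Set.Icc a b, |iteratedDeriv (k + 1) G x| ≤ B) → ∀ (N : ℕ) [NeZero N] (i : Fin N),
    ∀ l ≤ k, ∀ s ∈ Set.Icc (0 : ℝ) 1,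
      |(derivative^[l] (cellProj k a b i G)).eval s -
        meshSize a b N ^ l * iteratedDeriv l G (xL a b i + meshSize a b N * s)| ≤
          K * B * meshSize a b N ^ (k + 1) := by
  obtain ⟨K, hK0, hK⟩ := exists_radau_error_cell k
  exact ⟨K, hK0, fun G hG B hB N _ i => hK G hG (xL a b i) (meshSize a b N) B
    (meshSize_pos hab N).le fun x hx => hB x (Icc_cell_subset hab i hx)⟩

/-- A function `G` such as the exact solution at a fixed time: it is subject to the boundary
condition `bc` together with its derivatives of order at most `k`, and `B` bounds its derivatives
of order at most `k + 2` on `[a,b]`. -/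
structure IsRegularProfile (bc : BoundaryCondition) (k : ℕ) (a b B : ℝ) (G : ℝ → ℝ) : Prop where
  contDiff : ContDiff ℝ (k + 2 : ℕ) G
  bound : ∀ l ≤ k + 2, ∀ x ∈ Set.Icc a b, |iteratedDeriv l G x| ≤ B
  compatible : ∀ l ≤ k, BoundaryCompatible bc a b (iteratedDeriv l G)

theorem IsRegularProfile.contDiff_of_le {bc : BoundaryCondition} {k : ℕ} {a b B : ℝ} {G : ℝ → ℝ}
    (hG : IsRegularProfile bc k a b B G) {n : ℕ} (hn : n ≤ k + 2) : ContDiff ℝ n G :=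
  hG.contDiff.of_le (by exact_mod_cast hn)

theorem IsRegularProfile.contDiff_neg_deriv {bc : BoundaryCondition} {k : ℕ} {a b B : ℝ}
    {G : ℝ → ℝ} (hG : IsRegularProfile bc k a b B G) :
    ContDiff ℝ (k + 1 : ℕ) fun x => -deriv G x :=
  (contDiff_succ_iff_deriv.mp (by exact_mod_cast hG.contDiff)).2.2.neg

theorem exists_derivative_cellProj_le (k : ℕ) {a b : ℝ} (hab : a < b) {B : ℝ} (hB : 0 ≤ B) :
    ∃ K : ℝ, 0 ≤ K ∧ ∀ (bc : BoundaryCondition) (G : ℝ → ℝ), IsRegularProfile bc k a b B G →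
      ∀ (N : ℕ) [NeZero N] (i : Fin N), ∀ s ∈ Set.Icc (0 : ℝ) 1,
        |(cellProj k a b i G).derivative.eval s| ≤ K * meshSize a b N := by
  obtain ⟨K, hK0, hK⟩ := exists_cellProj_error k hab
  have hba : 0 ≤ b - a := (sub_pos.mpr hab).le
  refine ⟨K * B * (b - a) ^ k + B, by positivity, fun bc G hG N _ i s hs => ?_⟩
  have hh := meshSize_pos hab N
  rcases Nat.eq_zero_or_pos k with rfl | hk
  · rw [derivative_of_natDegree_zero (Nat.le_zero.mp (natDegree_cellProj_le 0 a b i G)),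
      eval_zero, abs_zero]
    positivity
  · have herror := hK G (hG.contDiff_of_le (n := k + 1) (by omega)) B
      (hG.bound (k + 1) (by omega)) N i 1 hk s hs
    rw [Function.iterate_one, pow_one] at herror
    have hderiv : |meshSize a b N * iteratedDeriv 1 G (xL a b i + meshSize a b N * s)| ≤
        meshSize a b N * B := by
      rw [abs_mul, abs_of_pos hh]
      exact mul_le_mul_of_nonneg_left
        (hG.bound 1 (by omega) _ (add_meshSize_mul_mem_Icc hab i hs)) hh.le
    have hpow : K * B * meshSize a b N ^ (k + 1) ≤
        K * B * ((b - a) ^ k * meshSize a b N) := by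
      rw [pow_succ]
      gcongr
      exact meshSize_le hab N
    linarith [abs_sub_abs_le_abs_sub ((cellProj k a b i G).derivative.eval s)
      (meshSize a b N * iteratedDeriv 1 G (xL a b i + meshSize a b N * s))]

/-- The error of the discrete function `w` on cell `i` with respect to the projection of `G`, in
the reference variable. -/
noncomputable def projError (k : ℕ) (a b : ℝ) (G : ℝ → ℝ) {N : ℕ} (w : Fin N → ℝ[X])
    (i : Fin N) : ℝ[X] :=
  cellProj k a b i G - toRef a b i (w i)

/-- A quantity which bounds both the distance of `w` to the projection of `G` on cell `i` and
the projection error `h ^ (k + 1)`. -/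
noncomputable def errorSize (k : ℕ) (a b : ℝ) (G : ℝ → ℝ) {N : ℕ} (w : Fin N → ℝ[X])
    (i : Fin N) : ℝ :=
  l2Norm (projError k a b G w i) + meshSize a b N ^ (k + 1)

theorem pow_meshSize_le_errorSize (k : ℕ) (a b : ℝ) (G : ℝ → ℝ) {N : ℕ} (w : Fin N → ℝ[X])
    (i : Fin N) : meshSize a b N ^ (k + 1) ≤ errorSize k a b G w i :=
  le_add_of_nonneg_left (l2Norm_nonneg _)

section CellErrors

variable {a b : ℝ} (hab : a < b) (k : ℕ) (G : ℝ → ℝ) {N : ℕ} [NeZero N] (w : Fin N → ℝ[X])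
  (i : Fin N)

include hab

theorem l2Norm_projError_le_errorSize :
    l2Norm (projError k a b G w i) ≤ errorSize k a b G w i :=
  le_add_of_nonneg_right (pow_nonneg (meshSize_pos hab N).le _)

theorem errorSize_nonneg : 0 ≤ errorSize k a b G w i :=
  (l2Norm_nonneg _).trans (l2Norm_projError_le_errorSize hab k G w i)

end CellErrors

/-- The square of the error on `[a,b]` in the norm of `L²`, up to the factor `h` which comes from
the reference variable. -/
noncomputable def errorEnergy (k : ℕ) (a b : ℝ) (G : ℝ → ℝ) {N : ℕ} (w : Fin N → ℝ[X]) : ℝ :=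
  ∑ i, pairing (projError k a b G w i) (projError k a b G w i)

theorem sum_sq_errorSize_le (k : ℕ) (a b : ℝ) (G : ℝ → ℝ) {N : ℕ} (w : Fin N → ℝ[X]) :
    ∑ i, errorSize k a b G w i ^ 2 ≤
      2 * (errorEnergy k a b G w + N * (meshSize a b N ^ (k + 1)) ^ 2) := by
  calc ∑ i, errorSize k a b G w i ^ 2
      ≤ ∑ i, 2 * (pairing (projError k a b G w i) (projError k a b G w i) +
          (meshSize a b N ^ (k + 1)) ^ 2) := by
        refine Finset.sum_le_sum fun i _ => ?_
        rw [← sq_l2Norm]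
        exact add_sq_le
    _ = _ := by
        rw [← Finset.mul_sum, Finset.sum_add_distrib, Finset.sum_const, Finset.card_fin,
          nsmul_eq_mul, errorEnergy]

theorem sum_cyclic_mul_le {N : ℕ} [NeZero N] (e : Fin N → ℝ) :
    ∑ i, (e (i - 1) + e i + e (i + 1)) * e i ≤ 3 * ∑ i, e i ^ 2 := by
  have hleft : ∑ i, e (i - 1) ^ 2 = ∑ i, e i ^ 2 :=
    Equiv.sum_comp (Equiv.subRight (1 : Fin N)) fun i => e i ^ 2
  have hright : ∑ i, e (i + 1) ^ 2 = ∑ i, e i ^ 2 :=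
    Equiv.sum_comp (Equiv.addRight (1 : Fin N)) fun i => e i ^ 2
  calc ∑ i, (e (i - 1) + e i + e (i + 1)) * e i
      ≤ ∑ i, (e (i - 1) ^ 2 / 2 + 2 * e i ^ 2 + e (i + 1) ^ 2 / 2) :=
        Finset.sum_le_sum fun i _ => by
          linarith [two_mul_le_add_sq (e (i - 1)) (e i), two_mul_le_add_sq (e (i + 1)) (e i)]
    _ = 3 * ∑ i, e i ^ 2 := by
        rw [Finset.sum_add_distrib, Finset.sum_add_distrib, ← Finset.sum_div, ← Finset.sum_div,
          ← Finset.mul_sum, hleft, hright]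
        ring

/-! ### Growth of the error energy -/

theorem natDegree_projError_le {k : ℕ} (a b : ℝ) (G : ℝ → ℝ) {N : ℕ} {w : Fin N → ℝ[X]}
    (hw : w ∈ DGSpace N k) (i : Fin N) : (projError k a b G w i).natDegree ≤ k :=
  (natDegree_sub_le _ _).trans (max_le (natDegree_cellProj_le k a b i G)
    ((natDegree_toRef_le a b i (w i)).trans (hw i)))

theorem sq_sub_outerL_le {bc : BoundaryCondition} {k : ℕ} {a b B : ℝ} {G : ℝ → ℝ}
    (hG : IsRegularProfile bc k a b B G) {N : ℕ} [NeZero N] (w : Fin N → ℝ[X]) (i : Fin N) :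
    (G (xL a b i) - outerL bc a b w i) ^ 2 ≤ (projError k a b G w (i - 1)).eval 1 ^ 2 := by
  have hcompatible : BoundaryCompatible bc a b G := by
    simpa only [iteratedDeriv_zero] using hG.compatible 0 k.zero_le
  rw [sq_le_sq, projError, eval_sub, eval_one_cellProj, eval_one_toRef]
  exact abs_sub_outerL_le hcompatible w i

theorem cell_energy_le {bc : BoundaryCondition} {k : ℕ} {a b B : ℝ} {G : ℝ → ℝ}
    (hG : IsRegularProfile bc k a b B G) {N : ℕ} [NeZero N] {w : Fin N → ℝ[X]}
    (hw : w ∈ DGSpace N k) (i : Fin N) {s : ℝ} (hs : 0 ≤ s) {Wd : ℝ[X]}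
    (hWd : SatisfiesCellScheme k (meshSize a b N) s (outerL bc a b w i) (toRef a b i (w i)) Wd) :
    meshSize a b N * pairing (cellProj k a b i (fun x => -deriv G x) - Wd)
        (projError k a b G w i) ≤
      meshSize a b N * (∫ x in (0 : ℝ)..1, ((cellProj k a b i fun x => -deriv G x).eval x -
        -deriv G (xL a b i + meshSize a b N * x)) * (projError k a b G w i).eval x) +
      ((projError k a b G w (i - 1)).eval 1 ^ 2 - (projError k a b G w i).eval 1 ^ 2) / 2 +
      s * viscousForm (cellProj k a b i G) (projError k a b G w i) := by
  let x : ℝ → ℝ := fun s => xL a b i + meshSize a b N * s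
  have hx : ContDiff ℝ 1 x := by fun_prop
  have hG1 : ContDiff ℝ 1 G := hG.contDiff_of_le (n := 1) (by omega)
  have henergy := hWd.energy_le ((natDegree_toRef_le a b i (w i)).trans (hw i)) hs
    (g := fun s => G (x s)) (gt := fun s => -deriv G (x s)) (hG1.comp hx)
    (hG.contDiff_neg_deriv.continuous.comp hx.continuous) fun s => by
      have hchain := iteratedDeriv_comp_affine (l := 1) hG1 (xL a b i) (meshSize a b N) s
      rw [iteratedDeriv_one, iteratedDeriv_one, pow_one] at hchain
      rw [hchain, mul_neg]
  have hinflow := sq_sub_outerL_le hG w i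
  simp only [x, mul_zero, add_zero] at henergy
  exact henergy.trans (add_le_add (add_le_add le_rfl (div_le_div_of_nonneg_right
    (sub_le_sub_right hinflow _) zero_le_two)) le_rfl)

section EnergyRate

variable (k : ℕ) {a b : ℝ} (hab : a < b) {B : ℝ} (hB : 0 ≤ B)

include hab hB

theorem exists_iterate_derivative_error_le : ∃ K : ℝ, 0 ≤ K ∧ ∀ (bc : BoundaryCondition)
    (G : ℝ → ℝ), IsRegularProfile bc k a b B G → ∀ (N : ℕ) [NeZero N] (w : Fin N → ℝ[X]),
    w ∈ DGSpace N k → ∀ i, ∀ l ≤ k, ∀ s ∈ Set.Icc (0 : ℝ) 1,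
      |meshSize a b N ^ l * iteratedDeriv l G (xL a b i + meshSize a b N * s) -
        (derivative^[l] (toRef a b i (w i))).eval s| ≤ K * errorSize k a b G w i := by
  obtain ⟨K, hK0, hK⟩ := exists_cellProj_error k hab
  obtain ⟨KI, hKI0, hKI⟩ := exists_inverse_inequality k k
  refine ⟨KI + K * B, by positivity, fun bc G hG N _ w hw i l hl s hs => ?_⟩
  have hproj := hK G (hG.contDiff_of_le (n := k + 1) (by omega)) B
    (hG.bound (k + 1) (by omega)) N i l hl s hs
  have hdiscrete := hKI _ (natDegree_projError_le a b G hw i) l hl s hs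
  rw [projError, iterate_map_sub, eval_sub, ← projError] at hdiscrete
  calc _ ≤ K * B * meshSize a b N ^ (k + 1) + KI * l2Norm (projError k a b G w i) :=
        (abs_sub_le _ ((derivative^[l] (cellProj k a b i G)).eval s) _).trans
          (add_le_add (by rwa [abs_sub_comm]) hdiscrete)
    _ ≤ K * B * errorSize k a b G w i + KI * errorSize k a b G w i := by
        gcongr
        · exact pow_meshSize_le_errorSize k a b G w i
        · exact l2Norm_projError_le_errorSize hab k G w i
    _ = (KI + K * B) * errorSize k a b G w i := by ring

theorem exists_sigma_div_meshSize_le (C : ℝ) {c₀ : ℝ} (hc₀ : 0 ≤ c₀) : ∃ S : ℝ, 0 ≤ S ∧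
    ∀ (bc : BoundaryCondition) (G : ℝ → ℝ), IsRegularProfile bc k a b B G →
    ∀ (N : ℕ) [NeZero N] (w : Fin N → ℝ[X]), w ∈ DGSpace N k → ∀ i,
      sigma linearSquare bc k C c₀ a b w i / meshSize a b N ≤
        S * (errorSize k a b G w (i - 1) + errorSize k a b G w i +
          errorSize k a b G w (i + 1)) := by
  obtain ⟨K, hK0, hK⟩ := exists_iterate_derivative_error_le k hab hB
  refine ⟨max 1 C * (c₀ * ((1 + ∑ l ∈ Finset.Icc 1 k, (l : ℝ) * (l + 1)) * (2 * K))),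
    mul_nonneg (zero_le_one.trans (le_max_left 1 C)) (by positivity),
    fun bc G hG N _ w hw i => ?_⟩
  refine (sigma_div_meshSize_le hab C hc₀ hG.compatible w
    (fun i => K * errorSize k a b G w i) (hK bc G hG N w hw) i).trans_eq ?_
  ring

theorem exists_integral_cellProj_neg_deriv_sub_le : ∃ K : ℝ, 0 ≤ K ∧
    ∀ (bc : BoundaryCondition) (G : ℝ → ℝ), IsRegularProfile bc k a b B G →
    ∀ (N : ℕ) [NeZero N] (i : Fin N) (q : ℝ[X]),
      ∫ s in (0 : ℝ)..1, ((cellProj k a b i fun x => -deriv G x).eval s -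
        -deriv G (xL a b i + meshSize a b N * s)) * q.eval s ≤
          K * meshSize a b N ^ (k + 1) * l2Norm q := by
  obtain ⟨K, hK0, hK⟩ := exists_cellProj_error k hab
  refine ⟨K * B, by positivity, fun bc G hG N _ i q => ?_⟩
  have hcont : Continuous fun s => -deriv G (xL a b i + meshSize a b N * s) :=
    hG.contDiff_neg_deriv.continuous.comp
      (g := fun x => -deriv G x) (f := fun s => xL a b i + meshSize a b N * s) (by fun_prop)
  have hbound : ∀ x ∈ Set.Icc a b, |iteratedDeriv (k + 1) (fun x => -deriv G x) x| ≤ B :=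
    fun x hx => by
      have hneg : iteratedDeriv (k + 1) (fun x => -deriv G x) x = -iteratedDeriv (k + 2) G x := by
        rw [iteratedDeriv_succ' (n := k + 1)]
        exact iteratedDeriv_neg (k + 1) (deriv G) x
      rw [hneg, abs_neg]
      exact hG.bound (k + 2) le_rfl x hx
  refine (le_abs_self _).trans (abs_integral_mul_eval_le
    ((Polynomial.continuous _).fun_sub hcont) (fun s hs => ?_) q)
  simpa only [Function.iterate_zero, id, pow_zero, one_mul, iteratedDeriv_zero] using
    hK _ hG.contDiff_neg_deriv B hbound N i 0 k.zero_le s hs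

theorem exists_viscousForm_cellProj_le : ∃ K : ℝ, 0 ≤ K ∧
    ∀ (bc : BoundaryCondition) (G : ℝ → ℝ), IsRegularProfile bc k a b B G →
    ∀ (N : ℕ) [NeZero N] (i : Fin N) (q : ℝ[X]), q.natDegree ≤ k →
      viscousForm (cellProj k a b i G) q ≤ K * meshSize a b N * l2Norm q := by
  obtain ⟨KP, hKP0, hKP⟩ := exists_derivative_cellProj_le k hab hB
  obtain ⟨KI, hKI0, hKI⟩ := exists_inverse_inequality k 1
  refine ⟨KP * KI, by positivity, fun bc G hG N _ i q hq => ?_⟩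
  have hh := (meshSize_pos hab N).le
  have hpoint : ∀ s ∈ Set.uIoc (0 : ℝ) 1,
      ‖nuRef s * (cellProj k a b i G).derivative.eval s * q.derivative.eval s‖ ≤
        1 * (KP * meshSize a b N) * (KI * l2Norm q) := fun s hs => by
    have hs' : s ∈ Set.Icc (0 : ℝ) 1 :=
      Set.Ioc_subset_Icc_self (Set.uIoc_of_le (zero_le_one' ℝ) ▸ hs)
    obtain ⟨hν0, hν1⟩ := nuRef_mem_Icc hs'
    rw [Real.norm_eq_abs, abs_mul, abs_mul, abs_of_nonneg hν0]
    exact mul_le_mul (mul_le_mul hν1 (hKP bc G hG N i s hs') (abs_nonneg _) zero_le_one)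
      (hKI q hq 1 le_rfl s hs') (abs_nonneg _) (by positivity)
  calc viscousForm (cellProj k a b i G) q ≤ ‖viscousForm (cellProj k a b i G) q‖ := le_abs_self _
    _ ≤ 1 * (KP * meshSize a b N) * (KI * l2Norm q) * |1 - 0| :=
        intervalIntegral.norm_integral_le_of_norm_le_const hpoint
    _ = KP * KI * meshSize a b N * l2Norm q := by
        rw [sub_zero, abs_one]; ring

theorem exists_pairing_projError_le (C : ℝ) {c₀ : ℝ} (hc₀ : 0 ≤ c₀) : ∃ K : ℝ, 0 ≤ K ∧
    ∀ (bc : BoundaryCondition) (G : ℝ → ℝ), IsRegularProfile bc k a b B G →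
    ∀ (N : ℕ) [NeZero N] (w : Fin N → ℝ[X]), w ∈ DGSpace N k → ∀ i (Wd : ℝ[X]),
    SatisfiesCellScheme k (meshSize a b N) (sigma linearSquare bc k C c₀ a b w i / meshSize a b N)
      (outerL bc a b w i) (toRef a b i (w i)) Wd →
    meshSize a b N * pairing (cellProj k a b i (fun x => -deriv G x) - Wd)
        (projError k a b G w i) ≤
      meshSize a b N * (K * ((errorSize k a b G w (i - 1) + errorSize k a b G w i +
        errorSize k a b G w (i + 1)) * errorSize k a b G w i)) +
      ((projError k a b G w (i - 1)).eval 1 ^ 2 - (projError k a b G w i).eval 1 ^ 2) / 2 := by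
  obtain ⟨KT, hKT0, hKT⟩ := exists_integral_cellProj_neg_deriv_sub_le k hab hB
  obtain ⟨KV, hKV0, hKV⟩ := exists_viscousForm_cellProj_le k hab hB
  obtain ⟨S, hS0, hS⟩ := exists_sigma_div_meshSize_le k hab hB C hc₀
  refine ⟨KT + S * KV, by positivity, fun bc G hG N _ w hw i Wd hWd => ?_⟩
  have hh := meshSize_pos hab N
  have he := errorSize_nonneg hab k G w
  have hσ : 0 ≤ sigma linearSquare bc k C c₀ a b w i / meshSize a b N :=
    div_nonneg (sigma_linearSquare_nonneg hab bc k C hc₀ w i) hh.le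
  have henergy := cell_energy_le hG hw i hσ hWd
  have hneighbours : errorSize k a b G w i ≤
      errorSize k a b G w (i - 1) + errorSize k a b G w i + errorSize k a b G w (i + 1) := by
    linarith [he (i - 1), he (i + 1)]
  have hprojection := calc
    ∫ s in (0 : ℝ)..1, ((cellProj k a b i fun x => -deriv G x).eval s -
        -deriv G (xL a b i + meshSize a b N * s)) * (projError k a b G w i).eval s
      ≤ KT * meshSize a b N ^ (k + 1) * l2Norm (projError k a b G w i) := hKT bc G hG N i _
    _ ≤ KT * (errorSize k a b G w (i - 1) + errorSize k a b G w i + errorSize k a b G w (i + 1)) *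
          errorSize k a b G w i :=
        mul_le_mul (mul_le_mul_of_nonneg_left
            ((pow_meshSize_le_errorSize k a b G w i).trans hneighbours) hKT0)
          (l2Norm_projError_le_errorSize hab k G w i) (l2Norm_nonneg _)
          (mul_nonneg hKT0 ((he i).trans hneighbours))
  have hviscous := calc
    sigma linearSquare bc k C c₀ a b w i / meshSize a b N *
        viscousForm (cellProj k a b i G) (projError k a b G w i)
      ≤ sigma linearSquare bc k C c₀ a b w i / meshSize a b N *
          (KV * meshSize a b N * errorSize k a b G w i) :=
        mul_le_mul_of_nonneg_left ((hKV bc G hG N i _ (natDegree_projError_le a b G hw i)).trans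
          (mul_le_mul_of_nonneg_left (l2Norm_projError_le_errorSize hab k G w i)
            (by positivity))) hσ
    _ ≤ S * (errorSize k a b G w (i - 1) + errorSize k a b G w i + errorSize k a b G w (i + 1)) *
          (KV * meshSize a b N * errorSize k a b G w i) :=
        mul_le_mul_of_nonneg_right (hS bc G hG N w hw i) (mul_nonneg (by positivity) (he i))
  linarith [mul_le_mul_of_nonneg_left hprojection hh.le]

theorem exists_sum_pairing_projError_le (C : ℝ) {c₀ : ℝ} (hc₀ : 0 ≤ c₀) : ∃ K : ℝ, 0 ≤ K ∧
    ∀ (bc : BoundaryCondition) (G : ℝ → ℝ), IsRegularProfile bc k a b B G →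
    ∀ (N : ℕ) [NeZero N] (w : Fin N → ℝ[X]), w ∈ DGSpace N k → ∀ Wd : Fin N → ℝ[X],
    (∀ i, SatisfiesCellScheme k (meshSize a b N)
      (sigma linearSquare bc k C c₀ a b w i / meshSize a b N) (outerL bc a b w i)
      (toRef a b i (w i)) (Wd i)) →
    ∑ i, pairing (cellProj k a b i (fun x => -deriv G x) - Wd i) (projError k a b G w i) ≤
      K * (errorEnergy k a b G w + N * (meshSize a b N ^ (k + 1)) ^ 2) := by
  obtain ⟨K, hK0, hK⟩ := exists_pairing_projError_le k hab hB C hc₀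
  refine ⟨6 * K, by positivity, fun bc G hG N _ w hw Wd hWd => ?_⟩
  have hoverlap := sum_cyclic_mul_le (errorSize k a b G w)
  have hsum := Finset.sum_le_sum fun i (_ : i ∈ Finset.univ) => hK bc G hG N w hw i (Wd i) (hWd i)
  have htelescope : ∑ i, (projError k a b G w (i - 1)).eval 1 ^ 2 =
      ∑ i, (projError k a b G w i).eval 1 ^ 2 :=
    Equiv.sum_comp (Equiv.subRight (1 : Fin N)) fun i => (projError k a b G w i).eval 1 ^ 2
  rw [Finset.sum_add_distrib, ← Finset.sum_div, Finset.sum_sub_distrib, htelescope, sub_self,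
    zero_div, add_zero, ← Finset.mul_sum, ← Finset.mul_sum, ← Finset.mul_sum] at hsum
  calc _ ≤ K * ∑ i, (errorSize k a b G w (i - 1) + errorSize k a b G w i +
          errorSize k a b G w (i + 1)) * errorSize k a b G w i :=
        le_of_mul_le_mul_left hsum (meshSize_pos hab N)
    _ ≤ K * (3 * (2 * (errorEnergy k a b G w + N * (meshSize a b N ^ (k + 1)) ^ 2))) := by
        gcongr
        exact hoverlap.trans (by gcongr; exact sum_sq_errorSize_le k a b G w)
    _ = _ := by ring

end EnergyRate

/-! ### Evolution of the error -/

/-- `F` is a curve of polynomials of degree at most `k` on `s` whose derivative within `s` at `t`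
is the polynomial `F'`. Differentiation is coefficientwise, as `ℝ[X]` carries no topology. -/
structure HasPolyDerivWithinAt (k : ℕ) (F : ℝ → ℝ[X]) (F' : ℝ[X]) (s : Set ℝ) (t : ℝ) : Prop where
  natDegree_le : ∀ τ ∈ s, (F τ).natDegree ≤ k
  natDegree_deriv_le : F'.natDegree ≤ k
  coeff : ∀ n ≤ k, HasDerivWithinAt (fun τ => (F τ).coeff n) (F'.coeff n) s t

theorem map_eq_sum_coeff_mul {k : ℕ} {p : ℝ[X]} (hp : p.natDegree ≤ k) (ℓ : ℝ[X] →ₗ[ℝ] ℝ) :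
    ℓ p = ∑ n ∈ Finset.range (k + 1), p.coeff n * ℓ (X ^ n) := by
  conv_lhs => rw [p.as_sum_range_C_mul_X_pow' (Nat.lt_succ_of_le hp)]
  simp only [map_sum, ← smul_eq_C_mul, map_smul, smul_eq_mul]

theorem exists_hasPolyDerivWithinAt {k : ℕ} {F : ℝ → ℝ[X]} {s : Set ℝ} {t : ℝ}
    (hF : ∀ τ ∈ s, (F τ).natDegree ≤ k)
    (hdiff : ∀ n ≤ k, DifferentiableWithinAt ℝ (fun τ => (F τ).coeff n) s t) :
    ∃ F', HasPolyDerivWithinAt k F F' s t := by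
  refine ⟨∑ n ∈ Finset.range (k + 1), C (derivWithin (fun τ => (F τ).coeff n) s t) * X ^ n,
    hF, natDegree_sum_le_of_forall_le _ _ fun n hn => ?_, fun n hn => ?_⟩
  · exact (natDegree_C_mul_X_pow_le _ _).trans (Nat.lt_succ_iff.mp (Finset.mem_range.mp hn))
  · exact (hdiff n hn).hasDerivWithinAt.congr_deriv (by simp [coeff_X_pow, hn])

namespace HasPolyDerivWithinAt

variable {k : ℕ} {F G : ℝ → ℝ[X]} {F' G' : ℝ[X]} {s : Set ℝ} {t : ℝ}

theorem map (hF : HasPolyDerivWithinAt k F F' s t) (ht : t ∈ s) (ℓ : ℝ[X] →ₗ[ℝ] ℝ) :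
    HasDerivWithinAt (fun τ => ℓ (F τ)) (ℓ F') s t := by
  have hsum : HasDerivWithinAt
      (fun τ => ∑ n ∈ Finset.range (k + 1), (F τ).coeff n * ℓ (X ^ n)) (ℓ F') s t := by
    rw [map_eq_sum_coeff_mul hF.natDegree_deriv_le]
    exact HasDerivWithinAt.fun_sum fun n hn =>
      (hF.coeff n (Nat.lt_succ_iff.mp (Finset.mem_range.mp hn))).mul_const _
  exact hsum.congr_of_mem (fun τ hτ => map_eq_sum_coeff_mul (hF.natDegree_le τ hτ) ℓ) ht

theorem sub (hF : HasPolyDerivWithinAt k F F' s t) (hG : HasPolyDerivWithinAt k G G' s t) :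
    HasPolyDerivWithinAt k (fun τ => F τ - G τ) (F' - G') s t where
  natDegree_le τ hτ :=
    (natDegree_sub_le _ _).trans (max_le (hF.natDegree_le τ hτ) (hG.natDegree_le τ hτ))
  natDegree_deriv_le :=
    (natDegree_sub_le _ _).trans (max_le hF.natDegree_deriv_le hG.natDegree_deriv_le)
  coeff n hn := by
    simp only [coeff_sub]
    exact (hF.coeff n hn).fun_sub (hG.coeff n hn)

theorem toRef (hF : HasPolyDerivWithinAt k F F' s t) (ht : t ∈ s) (a b : ℝ) {N : ℕ} (i : Fin N) :
    HasPolyDerivWithinAt k (fun τ => toRef a b i (F τ)) (toRef a b i F') s t where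
  natDegree_le τ hτ := (natDegree_toRef_le a b i _).trans (hF.natDegree_le τ hτ)
  natDegree_deriv_le := (natDegree_toRef_le a b i _).trans hF.natDegree_deriv_le
  coeff n _ := hF.map ht (lcoeff ℝ n ∘ₗ (NOESDG.toRef a b i).toLinearMap)

theorem pairing_self (hF : HasPolyDerivWithinAt k F F' s t) (ht : t ∈ s) :
    HasDerivWithinAt (fun τ => pairing (F τ) (F τ)) (2 * pairing F' (F t)) s t := by
  have hsum : HasDerivWithinAt
      (fun τ => ∑ n ∈ Finset.range (k + 1), (F τ).coeff n * pairing (X ^ n) (F τ))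
      (2 * pairing F' (F t)) s t := by
    refine (HasDerivWithinAt.fun_sum fun n hn =>
      (hF.coeff n (Nat.lt_succ_iff.mp (Finset.mem_range.mp hn))).mul
        (hF.map ht (pairing (X ^ n)))).congr_deriv ?_
    simp only [pairing_comm (X ^ _)]
    rw [Finset.sum_add_distrib, ← map_eq_sum_coeff_mul hF.natDegree_deriv_le (pairing (F t)),
      ← map_eq_sum_coeff_mul (hF.natDegree_le t ht) (pairing F'), pairing_comm (F t), two_mul]
  simp only [pairing_comm (X ^ _)] at hsum
  exact hsum.congr_of_mem
    (fun τ hτ => map_eq_sum_coeff_mul (hF.natDegree_le τ hτ) (pairing (F τ))) ht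

end HasPolyDerivWithinAt

theorem hasPolyDerivWithinAt_cellProj (k : ℕ) {g : ℝ → ℝ} (hg : ContDiff ℝ 1 g) (a b : ℝ) {N : ℕ}
    (i : Fin N) (s : Set ℝ) (t : ℝ) :
    HasPolyDerivWithinAt k (fun τ => cellProj k a b i fun x => g (x - τ))
      (cellProj k a b i fun x => -deriv (fun x => g (x - t)) x) s t where
  natDegree_le τ _ := natDegree_cellProj_le k a b i _
  natDegree_deriv_le := natDegree_cellProj_le k a b i _
  coeff n _ := by
    simp only [deriv_comp_sub_const]
    exact (hasDerivAt_coeff_radau k hg n (xL a b i) (meshSize a b N) t).hasDerivWithinAt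

theorem hasDerivWithinAt_errorEnergy {k : ℕ} {g : ℝ → ℝ} (hg : ContDiff ℝ 1 g) (a b : ℝ) {N : ℕ}
    {uh : ℝ → Fin N → ℝ[X]} {ut : Fin N → ℝ[X]} {s : Set ℝ} {t : ℝ} (ht : t ∈ s)
    (huh : ∀ i, HasPolyDerivWithinAt k (fun τ => uh τ i) (ut i) s t) :
    HasDerivWithinAt (fun τ => errorEnergy k a b (fun x => g (x - τ)) (uh τ))
      (2 * ∑ i, pairing
        (cellProj k a b i (fun x => -deriv (fun x => g (x - t)) x) - toRef a b i (ut i))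
        (projError k a b (fun x => g (x - t)) (uh t) i)) s t := by
  rw [Finset.mul_sum]
  exact HasDerivWithinAt.fun_sum fun i _ =>
    ((hasPolyDerivWithinAt_cellProj k hg a b i s t).sub ((huh i).toRef ht a b i)).pairing_self ht

theorem add_le_exp_mul_of_hasDerivWithinAt_le {E E' : ℝ → ℝ} {T K D : ℝ}
    (hE : ∀ t ∈ Set.Icc 0 T, HasDerivWithinAt E (E' t) (Set.Icc 0 T) t)
    (hle : ∀ t ∈ Set.Ico 0 T, E' t ≤ K * (E t + D)) {t : ℝ} (ht : t ∈ Set.Icc 0 T) :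
    E t + D ≤ (E 0 + D) * Real.exp (K * t) := by
  have hgronwall := le_gronwallBound_of_liminf_deriv_right_le (f := fun t => E t + D) (f' := E')
    (ε := 0) (fun t ht => ((hE t ht).add_const D).continuousWithinAt) (fun t ht r hr => ?_)
    le_rfl (fun t ht => (hle t ht).trans_eq (add_zero _).symm) t ht
  · rwa [gronwallBound_ε0, sub_zero] at hgronwall
  · have hright : HasDerivWithinAt (fun t => E t + D) (E' t) (Set.Ici t) t :=
      ((hE t (Set.Ico_subset_Icc_self ht)).add_const D).mono_of_mem_nhdsWithin
        (Icc_mem_nhdsGE_of_mem ht)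
    simpa only [slope_def_field, div_eq_inv_mul] using hright.liminf_right_slope_le hr

/-! ### The error estimate -/

theorem IsSolution.initial_toRef {a b T : ℝ} (hab : a < b) {L : EntropyLaw}
    {bc : BoundaryCondition} {k N : ℕ} [NeZero N] {C c₀ : ℝ} {u₀ : ℝ → ℝ} {uh : ℝ → Fin N → ℝ[X]}
    (h : IsSolution L bc k C c₀ a b T u₀ uh) (i : Fin N) {q : ℝ[X]} (hq : q.natDegree ≤ k) :
    pairing (toRef a b i (uh 0 i)) q =
      ∫ s in (0 : ℝ)..1, u₀ (xL a b i + meshSize a b N * s) * q.eval s := by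
  have hh := (meshSize_pos hab N).ne'
  obtain ⟨φ, hφ, rfl⟩ := exists_toRef_eq hh i q
  have hinitial := h.initial i φ (hφ.trans hq)
  rw [integral_cell, integral_cell] at hinitial
  simpa only [pairing_apply, eval_toRef] using mul_left_cancel₀ hh hinitial

theorem pairing_sub_self_le_of_projection {g : ℝ → ℝ} (hg : Continuous g) {p W : ℝ[X]}
    (hproj : pairing W (p - W) = ∫ s in (0 : ℝ)..1, g s * (p - W).eval s) {ε : ℝ}
    (hε : ∀ s ∈ Set.Icc (0 : ℝ) 1, |p.eval s - g s| ≤ ε) :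
    pairing (p - W) (p - W) ≤ ε ^ 2 := by
  have hdiff : pairing (p - W) (p - W) =
      ∫ s in (0 : ℝ)..1, (p.eval s - g s) * (p - W).eval s := by
    simp only [sub_mul]
    rw [LinearMap.map_sub₂, hproj, pairing_apply, intervalIntegral.integral_sub
      (Continuous.intervalIntegrable (by fun_prop) _ _)
      (Continuous.intervalIntegrable (by fun_prop) _ _)]
  have hle : l2Norm (p - W) ^ 2 ≤ ε * l2Norm (p - W) := by
    rw [sq_l2Norm, hdiff]
    exact (le_abs_self _).trans (abs_integral_mul_eval_le (by fun_prop) hε _)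
  rw [← sq_l2Norm]
  nlinarith [sq_nonneg (ε - l2Norm (p - W))]

theorem integral_sq_sub_le {g : ℝ → ℝ} (hg : Continuous g) {p W : ℝ[X]} {ε : ℝ}
    (hε : ∀ s ∈ Set.Icc (0 : ℝ) 1, |p.eval s - g s| ≤ ε) :
    ∫ s in (0 : ℝ)..1, (g s - W.eval s) ^ 2 ≤ 2 * (ε ^ 2 + pairing (p - W) (p - W)) := by
  calc ∫ s in (0 : ℝ)..1, (g s - W.eval s) ^ 2
      ≤ ∫ s in (0 : ℝ)..1, 2 * (ε ^ 2 + (p - W).eval s ^ 2) := by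
        refine intervalIntegral.integral_mono_on zero_le_one
          (Continuous.intervalIntegrable (by fun_prop) _ _)
          (Continuous.intervalIntegrable (by fun_prop) _ _) fun s hs => ?_
        have hsplit : g s - W.eval s = (g s - p.eval s) + (p - W).eval s := by
          rw [eval_sub]; ring
        rw [hsplit]
        refine add_sq_le.trans (mul_le_mul_of_nonneg_left (add_le_add ?_ le_rfl) zero_le_two)
        rw [← sq_abs, abs_sub_comm]
        exact pow_le_pow_left₀ (abs_nonneg _) (hε s hs) 2
    _ = 2 * (ε ^ 2 + pairing (p - W) (p - W)) := by
        rw [intervalIntegral.integral_const_mul, intervalIntegral.integral_add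
          (Continuous.intervalIntegrable (by fun_prop) _ _)
          (Continuous.intervalIntegrable (by fun_prop) _ _), pairing_self]
        simp

theorem sq_l2Error_le {a b : ℝ} (hab : a < b) (k : ℕ) {N : ℕ} [NeZero N] {G : ℝ → ℝ}
    (hG : Continuous G) {ε : ℝ} (hε : ∀ i : Fin N, ∀ s ∈ Set.Icc (0 : ℝ) 1,
      |(cellProj k a b i G).eval s - G (xL a b i + meshSize a b N * s)| ≤ ε)
    (w : Fin N → ℝ[X]) :
    l2Error a b G w ^ 2 ≤ 2 * (b - a) * ε ^ 2 + 2 * meshSize a b N * errorEnergy k a b G w := by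
  have hh := (meshSize_pos hab N).le
  have hnonneg : 0 ≤ ∑ i : Fin N, ∫ x in (xL a b i)..(xR a b i), (G x - (w i).eval x) ^ 2 :=
    Finset.sum_nonneg fun i _ => intervalIntegral.integral_nonneg
      (by rw [xR_eq]; exact le_add_of_nonneg_right hh) fun x _ => sq_nonneg _
  rw [l2Error, Real.sq_sqrt hnonneg]
  calc ∑ i : Fin N, ∫ x in (xL a b i)..(xR a b i), (G x - (w i).eval x) ^ 2
      ≤ ∑ i : Fin N, meshSize a b N *
          (2 * (ε ^ 2 + pairing (projError k a b G w i) (projError k a b G w i))) := by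
        refine Finset.sum_le_sum fun i _ => ?_
        rw [integral_cell]
        refine mul_le_mul_of_nonneg_left ?_ hh
        simpa only [eval_toRef, projError] using integral_sq_sub_le (W := toRef a b i (w i))
          (g := fun s => G (xL a b i + meshSize a b N * s)) (by fun_prop) (hε i)
    _ = 2 * (b - a) * ε ^ 2 + 2 * meshSize a b N * errorEnergy k a b G w := by
        rw [← Finset.mul_sum, ← Finset.mul_sum, Finset.sum_add_distrib, Finset.sum_const,
          Finset.card_fin, nsmul_eq_mul, ← card_mul_meshSize a b N, errorEnergy]
        ring

section ErrorEstimate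

variable (k : ℕ) {a b : ℝ} (hab : a < b)

include hab

theorem exists_abs_cellProj_sub_le (B : ℝ) : ∃ K : ℝ, ∀ (bc : BoundaryCondition) (G : ℝ → ℝ),
    IsRegularProfile bc k a b B G → ∀ (N : ℕ) [NeZero N] (i : Fin N), ∀ s ∈ Set.Icc (0 : ℝ) 1,
      |(cellProj k a b i G).eval s - G (xL a b i + meshSize a b N * s)| ≤
        K * meshSize a b N ^ (k + 1) := by
  obtain ⟨K, -, hK⟩ := exists_cellProj_error k hab
  refine ⟨K * B, fun bc G hG N _ i s hs => ?_⟩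
  simpa only [Function.iterate_zero, id, pow_zero, one_mul, iteratedDeriv_zero] using
    hK G (hG.contDiff_of_le (n := k + 1) (by omega)) B (hG.bound (k + 1) (by omega)) N i 0
      k.zero_le s hs

theorem exists_initial_errorEnergy_le (B : ℝ) : ∃ K : ℝ, 0 ≤ K ∧ ∀ (L : EntropyLaw)
    (bc : BoundaryCondition) (g : ℝ → ℝ), IsRegularProfile bc k a b B g → ∀ (C c₀ T : ℝ) (N : ℕ)
    [NeZero N] (uh : ℝ → Fin N → ℝ[X]), IsSolution L bc k C c₀ a b T g uh → 0 ≤ T →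
      errorEnergy k a b g (uh 0) ≤ K * (N * (meshSize a b N ^ (k + 1)) ^ 2) := by
  obtain ⟨K, hK⟩ := exists_abs_cellProj_sub_le k hab B
  refine ⟨K ^ 2, by positivity, fun L bc g hg C c₀ T N _ uh h hT => ?_⟩
  have hcont := (hg.contDiff_of_le (n := 0) (by omega)).continuous
  have hcell : ∀ i, pairing (projError k a b g (uh 0) i) (projError k a b g (uh 0) i) ≤
      (K * meshSize a b N ^ (k + 1)) ^ 2 := fun i =>
    pairing_sub_self_le_of_projection (by fun_prop)
      (h.initial_toRef hab i (natDegree_projError_le a b g (h.mem 0 ⟨le_rfl, hT⟩) i))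
      (hK bc g hg N i)
  calc errorEnergy k a b g (uh 0) ≤ ∑ _i : Fin N, (K * meshSize a b N ^ (k + 1)) ^ 2 :=
        Finset.sum_le_sum fun i _ => hcell i
    _ = K ^ 2 * (N * (meshSize a b N ^ (k + 1)) ^ 2) := by
        rw [Finset.sum_const, Finset.card_fin, nsmul_eq_mul]; ring

variable {B : ℝ} (hB : 0 ≤ B)

include hB

theorem exists_deriv_errorEnergy_le (C : ℝ) {c₀ : ℝ} (hc₀ : 0 ≤ c₀) : ∃ K : ℝ, 0 ≤ K ∧
    ∀ (bc : BoundaryCondition) (g : ℝ → ℝ) (T : ℝ),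
    (∀ t ∈ Set.Icc 0 T, IsRegularProfile bc k a b B fun x => g (x - t)) →
    ∀ (N : ℕ) [NeZero N] (uh : ℝ → Fin N → ℝ[X]),
    IsSolution linearSquare bc k C c₀ a b T g uh → ∃ E' : ℝ → ℝ,
      (∀ t ∈ Set.Icc 0 T, HasDerivWithinAt
        (fun τ => errorEnergy k a b (fun x => g (x - τ)) (uh τ)) (E' t) (Set.Icc 0 T) t) ∧
      ∀ t ∈ Set.Ico 0 T, E' t ≤ K * (errorEnergy k a b (fun x => g (x - t)) (uh t) +
        N * (meshSize a b N ^ (k + 1)) ^ 2) := by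
  obtain ⟨K, hK0, hK⟩ := exists_sum_pairing_projError_le k hab hB C hc₀
  refine ⟨2 * K, by positivity, fun bc g T hg N _ uh h => ?_⟩
  have hderiv : ∀ t ∈ Set.Icc 0 T, ∀ i,
      ∃ Wd, HasPolyDerivWithinAt k (fun τ => uh τ i) Wd (Set.Icc 0 T) t := fun t ht i =>
    exists_hasPolyDerivWithinAt (fun τ hτ => h.mem τ hτ i) fun n _ => h.differentiable i n t ht
  choose! ut hut using hderiv
  refine ⟨_, fun t ht => hasDerivWithinAt_errorEnergy ?_ a b ht (hut t ht), fun t ht => ?_⟩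
  · have hg0 := (hg 0 ⟨le_rfl, ht.1.trans ht.2⟩).contDiff_of_le (n := 1) (by omega)
    simpa only [sub_zero, Nat.cast_one] using hg0
  · have ht' := Set.Ico_subset_Icc_self ht
    have hunique : UniqueDiffWithinAt ℝ (Set.Icc 0 T) t :=
      uniqueDiffOn_Icc (ht.1.trans_lt ht.2) t ht'
    rw [mul_assoc]
    exact mul_le_mul_of_nonneg_left (hK bc _ (hg t ht') N (uh t) (h.mem t ht') _ fun i =>
      h.satisfiesCellScheme hab ht' i fun s =>
        ((((hut t ht' i).toRef ht' a b i).map ht' (leval s)).derivWithin hunique)) zero_le_two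

theorem exists_errorEnergy_le (C : ℝ) {c₀ : ℝ} (hc₀ : 0 ≤ c₀) (T : ℝ) : ∃ K : ℝ, 0 ≤ K ∧
    ∀ (bc : BoundaryCondition) (g : ℝ → ℝ),
    (∀ t ∈ Set.Icc 0 T, IsRegularProfile bc k a b B fun x => g (x - t)) →
    ∀ (N : ℕ) [NeZero N] (uh : ℝ → Fin N → ℝ[X]),
    IsSolution linearSquare bc k C c₀ a b T g uh → ∀ t ∈ Set.Icc 0 T,
      errorEnergy k a b (fun x => g (x - t)) (uh t) ≤
        K * (N * (meshSize a b N ^ (k + 1)) ^ 2) := by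
  obtain ⟨K₀, hK₀0, hK₀⟩ := exists_initial_errorEnergy_le k hab B
  obtain ⟨K, hK0, hK⟩ := exists_deriv_errorEnergy_le k hab hB C hc₀
  refine ⟨(K₀ + 1) * Real.exp (K * T), by positivity, fun bc g hg N _ uh h t ht => ?_⟩
  have hT : 0 ≤ T := ht.1.trans ht.2
  obtain ⟨E', hderiv, hrate⟩ := hK bc g T hg N uh h
  have hgronwall := add_le_exp_mul_of_hasDerivWithinAt_le hderiv hrate ht
  have hg0 := hg 0 ⟨le_rfl, hT⟩
  simp only [sub_zero] at hgronwall hg0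
  have hD : 0 ≤ (N : ℝ) * (meshSize a b N ^ (k + 1)) ^ 2 := by positivity
  calc errorEnergy k a b (fun x => g (x - t)) (uh t)
      ≤ (errorEnergy k a b g (uh 0) + N * (meshSize a b N ^ (k + 1)) ^ 2) * Real.exp (K * t) :=
        (le_add_of_nonneg_right hD).trans hgronwall
    _ ≤ (K₀ * (N * (meshSize a b N ^ (k + 1)) ^ 2) + N * (meshSize a b N ^ (k + 1)) ^ 2) *
          Real.exp (K * T) := by
        gcongr
        · exact hK₀ linearSquare bc g hg0 C c₀ T N uh h hT
        · exact ht.2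
    _ = (K₀ + 1) * Real.exp (K * T) * (N * (meshSize a b N ^ (k + 1)) ^ 2) := by ring

theorem exists_l2Error_le (C : ℝ) {c₀ : ℝ} (hc₀ : 0 ≤ c₀) (T : ℝ) : ∃ M : ℝ, 0 < M ∧
    ∀ (bc : BoundaryCondition) (g : ℝ → ℝ),
    (∀ t ∈ Set.Icc 0 T, IsRegularProfile bc k a b B fun x => g (x - t)) →
    ∀ (N : ℕ) [NeZero N] (uh : ℝ → Fin N → ℝ[X]),
    IsSolution linearSquare bc k C c₀ a b T g uh → ∀ t ∈ Set.Icc 0 T,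
      l2Error a b (fun x => g (x - t)) (uh t) ≤ M * meshSize a b N ^ (k + 1) := by
  obtain ⟨KP, hKP⟩ := exists_abs_cellProj_sub_le k hab B
  obtain ⟨KE, hKE0, hKE⟩ := exists_errorEnergy_le k hab hB C hc₀ T
  have hba : 0 < b - a := sub_pos.mpr hab
  refine ⟨√(2 * (b - a) * (KP ^ 2 + KE + 1)), by positivity, fun bc g hg N _ uh h t ht => ?_⟩
  have hh := meshSize_pos hab N
  have hsq := sq_l2Error_le hab k ((hg t ht).contDiff_of_le (n := 0) (by omega)).continuous
    (hKP bc _ (hg t ht) N) (uh t)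
  refine le_of_sq_le_sq ?_ (by positivity)
  rw [mul_pow, Real.sq_sqrt (by positivity)]
  calc l2Error a b (fun x => g (x - t)) (uh t) ^ 2
      ≤ 2 * (b - a) * (KP * meshSize a b N ^ (k + 1)) ^ 2 +
          2 * meshSize a b N * (KE * (N * (meshSize a b N ^ (k + 1)) ^ 2)) :=
        hsq.trans (by gcongr; exact hKE bc g hg N uh h t ht)
    _ = 2 * (b - a) * (KP ^ 2 + KE) * (meshSize a b N ^ (k + 1)) ^ 2 := by
        rw [← card_mul_meshSize a b N]; ring
    _ ≤ 2 * (b - a) * (KP ^ 2 + KE + 1) * (meshSize a b N ^ (k + 1)) ^ 2 := by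
        gcongr ?_ * _
        exact mul_le_mul_of_nonneg_left (le_add_of_nonneg_right zero_le_one) (by positivity)

end ErrorEstimate

theorem exists_isRegularProfile_of_transport (k : ℕ) (a b : ℝ) {T : ℝ} (hT : 0 ≤ T)
    {bc : BoundaryCondition} {u : ℝ → ℝ → ℝ}
    (hu : ContDiffOn ℝ (k + 2 : ℕ) (fun p : ℝ × ℝ => u p.1 p.2) (Set.univ ×ˢ Set.Icc 0 T))
    (hpde : ∀ x, ∀ t ∈ Set.Ioo 0 T, deriv (fun s => u x s) t + deriv (fun y => u y t) x = 0)
    (hbc : ∀ t ∈ Set.Icc 0 T, ∀ l ≤ k,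
      BoundaryCompatible bc a b (iteratedDeriv l fun x => u x t)) :
    ∃ B : ℝ, 0 ≤ B ∧ ∀ t ∈ Set.Icc 0 T, IsRegularProfile bc k a b B fun x => u (x - t) 0 := by
  have hinit : ContDiff ℝ (k + 2 : ℕ) fun x => u x 0 :=
    contDiffOn_univ.mp <| hu.comp (f := fun x : ℝ => (x, (0 : ℝ)))
      (ContDiff.contDiffOn (by fun_prop)) fun _ _ => ⟨trivial, le_rfl, hT⟩
  have htransport : ∀ t ∈ Set.Icc 0 T, (fun x => u x t) = fun x => u (x - t) 0 := fun t ht =>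
    funext fun x => eq_initial_of_transport (hu.of_le (by exact_mod_cast Nat.le_add_left 1 _))
      hpde x ht
  obtain ⟨B, hB0, hB⟩ := exists_iteratedDeriv_bound hinit a b T
  refine ⟨B, hB0, fun t ht => ⟨hinit.comp (contDiff_id.sub contDiff_const), fun l hl x hx => ?_,
    fun l hl => htransport t ht ▸ hbc t ht l hl⟩⟩
  rw [iteratedDeriv_comp_sub_const l (fun x => u x 0)]
  exact hB l hl x hx t ht

end NOESDG

theorem mainTheorem2_general (a b : ℝ) (hab : a < b) (k : ℕ) (C c₀ T : ℝ) (hc₀ : 0 ≤ c₀)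
    (hT : 0 ≤ T) (bc : NOESDG.BoundaryCondition) (u : ℝ → ℝ → ℝ)
    (hu : ContDiffOn ℝ (k + 2 : ℕ) (fun p : ℝ × ℝ => u p.1 p.2) (Set.univ ×ˢ Set.Icc 0 T))
    (hpde : ∀ x, ∀ t ∈ Set.Ioo 0 T, deriv (fun s => u x s) t + deriv (fun y => u y t) x = 0)
    (hbc : ∀ t ∈ Set.Icc 0 T, ∀ l ≤ k,
      NOESDG.BoundaryCompatible bc a b (iteratedDeriv l fun x => u x t)) :
    ∃ M : ℝ, 0 < M ∧ ∀ (N : ℕ) [NeZero N] (uh : ℝ → Fin N → Polynomial ℝ),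
      NOESDG.IsSolution NOESDG.linearSquare bc k C c₀ a b T (fun x => u x 0) uh →
      ∀ t ∈ Set.Icc 0 T,
        NOESDG.l2Error a b (fun x => u x t) (uh t) ≤ M * NOESDG.meshSize a b N ^ (k + 1) := by
  obtain ⟨B, hB, hprofile⟩ :=
    NOESDG.exists_isRegularProfile_of_transport k a b hT hu hpde hbc
  obtain ⟨M, hM0, hM⟩ := NOESDG.exists_l2Error_le k hab hB C hc₀ T
  refine ⟨M, hM0, fun N _ uh huh t ht => ?_⟩
  have htransport : (fun x => u x t) = fun x => u (x - t) 0 := funext fun x =>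
    NOESDG.eq_initial_of_transport (hu.of_le (by exact_mod_cast Nat.le_add_left 1 _)) hpde x ht
  rw [htransport]
  exact hM bc (fun x => u x 0) hprofile N uh huh t ht

theorem mainTheorem2 (a b : ℝ) (hab : a < b) (k : ℕ) (C c₀ T : ℝ) (hC : 1 < C) (hc₀ : 0 ≤ c₀)
    (hT : 0 < T) (bc : NOESDG.BoundaryCondition) (u : ℝ → ℝ → ℝ)
    (hu : NOESDG.IsSmoothSolution NOESDG.linearSquare.f a b T bc u) :
    ∃ M : ℝ, 0 < M ∧ ∀ (N : ℕ) [NeZero N] (uh : ℝ → Fin N → Polynomial ℝ),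
      NOESDG.IsSolution NOESDG.linearSquare bc k C c₀ a b T (fun x => u x 0) uh →
      ∀ t ∈ Set.Icc 0 T,
        NOESDG.l2Error a b (fun x => u x t) (uh t) ≤ M * NOESDG.meshSize a b N ^ (k + 1) :=
  mainTheorem2_general a b hab k C c₀ T hc₀ hT.le bc u
    (contDiffOn_infty.mp hu.smooth (k + 2)) hu.pde fun _ ht l _ => hu.boundaryCompatible ht l
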